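/- **Setting.** A quantum set $\mathcal X$ is given by a set $\mathrm{At}(\mathcal X)$ of nonzero finite-dimensional complex Hilbert spaces, its atoms; its dual $\mathcal X^*$ has the atoms $X^*=L(X,\mathbb C)$, $X\in\mathrm{At}(\mathcal X)$. The von Neumann algebra $\ell^\infty(\mathcal X)=\bigoplus_{X}L(X)$ acts on the $\ell^2$-direct sum $H=\bigoplus_{X\in\mathrm{At}(\mathcal X)}X$, and $\mathrm{inc}_X\colon X\to H$ is the inclusion isometry. A binary relation $R$ on $\mathcal X$ is a choice of subspaces $R(X_1,X_2)\le L(X_1,X_2)$ for all atoms $X_1,X_2$. A relation of arity $(\mathcal X_1,\dots,\mathcal X_n)$ is a choice of subspaces $P(X_1\otimes\cdots\otimes X_n)\le L(X_1\otimes\cdots\otimes X_n,\mathbb C)$ for all atoms $X_i\in\mathrm{At}(\mathcal X_i)$; for $n=0$, it is a subspace of $L(\mathbb C,\mathbb C)$. These relations form a complete ortholattice, with all operations (including the orthocomplement $\neg$) defined atomwise. The product $P\times Q$ of relations is $P(X)\otimes Q(Y)$ on $X\otimes Y$. **Formulas.** Formulas are built from atomic formulas $P(x_1,\dots,x_n)$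 (with $P$ a relation of arity $(\mathcal X_1,\dots,\mathcal X_n)$ and $x_i$ distinct variables of sorts $\mathcal X_i$) by $\neg$, $\wedge$ and $(\forall x\in\mathcal X)$. In a context of distinct variables containing the free ones, a formula $\phi$ is interpreted as a relation $[\![\phi]\!]$ whose arity is the sequence of the sorts of these variables: an atomic formula $P(\dots)$ as the product of $P$ with the largest relation $\top$ in each variable of the context that does not occur in it (with tensor factors permuted to their places), $\neg$ as the orthocomplement, $\wedge$ as the meet, and $[\![(\forall x\in\mathcal X)\,\phi]\!]=\sup\{P : \top_{\mathcal X}\times P\le[\![\phi]\!]\}$, where $x$ is put first in the context of $\phi$. Furthermore, $\phi\vee\psi$ abbreviates $\neg(\neg\phi\wedge\neg\psi)$, and $\phi\to\psi$ abbreviates $\neg\phi\vee(\phi\wedge\psi)$. A sentence is true if its interpretation in the empty context is $\top$. The equality relation $E_{\mathcal X}$ has arity $(\mathcal X,\mathcal X^*)$: it is $\mathbb C\epsilon_X$ on $X\otimes X^*$, with $\epsilon_X$ the evaluation functional, and $0$ on $X_1\otimes X_2^*$ for distinct atoms $X_1,X_2$. The diagonal quantifier $(\forall(x=x_*)\in\mathcal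 X\times\mathcal X^*)\,\phi$ abbreviates $(\forall x_*\in\mathcal X^*)(\forall x\in\mathcal X)(E_{\mathcal X}(x,x_*)\to\phi)$. For a binary relation $R$ on $\mathcal X$, the relation $\breve R$ of arity $(\mathcal X,\mathcal X^*)$ consists, on $X_1\otimes X_2^*$, of the functionals $x\otimes\eta\mapsto\eta(rx)$ with $r\in R(X_1,X_2)$, and $\breve R_*$ of arity $(\mathcal X^*,\mathcal X)$ is its conjugate, which consists, on $X_1^*\otimes X_2$, of the functionals $\xi\otimes y\mapsto\xi(r^\dagger y)$ with $r\in R(X_1,X_2)$. A quantum preorder on a von Neumann algebra $M\subseteq L(H)$ is an ultraweakly closed algebra $V\subseteq L(H)$ that contains the commutant $M'$. **Theorem.** Let $\mathcal X$ be a quantum set. Consider the following sentences about a binary relation $R$ on $\mathcal X$: 1. (reflexivity) $(\forall(x=x_*)\in\mathcal X\times\mathcal X^*)\;\breve R(x,x_*)$; 2. (transitivity) $(\forall(x_1=x_{1*})\in\mathcal X\times\mathcal X^*)(\forall(x_2=x_{2*})\in\mathcal X\times\mathcal X^*)(\forall(x_3=x_{3*})\in\mathcal X\times\mathcal X^*)\;\big((\breve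 R(x_1,x_{2*})\wedge\breve R(x_2,x_{3*}))\to\breve R_*(x_{1*},x_3)\big)$; 3. (symmetry) $(\forall(x_1=x_{1*})\in\mathcal X\times\mathcal X^*)(\forall(x_2=x_{2*})\in\mathcal X\times\mathcal X^*)\;\big(\breve R(x_1,x_{2*})\to\breve R(x_2,x_{1*})\big)$. (a) The assignment $V\mapsto R$ with $R(X_1,X_2)=\mathrm{inc}_{X_2}^\dagger\cdot V\cdot\mathrm{inc}_{X_1}$ for $X_1,X_2\in\mathrm{At}(\mathcal X)$ is a bijection from the quantum preorders $V$ on $\ell^\infty(\mathcal X)$ onto the binary relations $R$ on $\mathcal X$ for which the sentences (1) and (2) are true. (b) The assignment $M\mapsto R$ with $R(X_1,X_2)=\mathrm{inc}_{X_2}^\dagger\cdot M'\cdot\mathrm{inc}_{X_1}$ for $X_1,X_2\in\mathrm{At}(\mathcal X)$ is a bijection from the von Neumann algebras $M\subseteq\ell^\infty(\mathcal X)$ (with the same unit) onto the binary relations $R$ on $\mathcal X$ for which the sentences (1), (2) and (3) are true. -/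

import Mathlib

open scoped InnerProductSpace Topology

universe u v

noncomputable section

/-! ### Quantum sets -/

/-- A quantum set: a family of nonzero finite-dimensional complex Hilbert spaces, its atoms.
The atoms are labelled by the type `At`; distinct labels are distinct atoms. -/
structure QuantumSet where
  At : Type u
  H : At → Type v
  [normed : ∀ i, NormedAddCommGroup (H i)]
  [inner : ∀ i, InnerProductSpace ℂ (H i)]
  [finDim : ∀ i, FiniteDimensional ℂ (H i)]
  [nontriv : ∀ i, Nontrivial (H i)]

attribute [instance] QuantumSet.normed QuantumSet.inner QuantumSet.finDim QuantumSet.nontriv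

instance QuantumSet.complete (X : QuantumSet.{u, v}) (i : X.At) : CompleteSpace (X.H i) :=
  FiniteDimensional.complete ℂ _

/-- The Hilbert space structure of the dual `H^* = L(H, ℂ)`, whose norm is the operator norm:
`⟪⟨x|, ⟨y|⟫ = ⟪y, x⟫`. -/
@[reducible]
def dualInnerProductSpace (H : Type v) [NormedAddCommGroup H] [InnerProductSpace ℂ H]
    [CompleteSpace H] : InnerProductSpace ℂ (StrongDual ℂ H) where
  inner ξ η := ⟪(InnerProductSpace.toDual ℂ H).symm η, (InnerProductSpace.toDual ℂ H).symm ξ⟫_ℂ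
  norm_sq_eq_re_inner ξ := by
    rw [← (InnerProductSpace.toDual ℂ H).symm.norm_map ξ, norm_sq_eq_re_inner (𝕜 := ℂ)]
  conj_inner_symm ξ η := inner_conj_symm _ _
  add_left ξ η ζ := by rw [map_add, inner_add_right]
  smul_left ξ η c := by rw [map_smulₛₗ, inner_smul_right]

/-- The dual quantum set: its atoms are the duals of the atoms of `X`. -/
abbrev QuantumSet.dual (X : QuantumSet.{u, v}) : QuantumSet.{u, v} where
  At := X.At
  H i := StrongDual ℂ (X.H i)
  normed _ := inferInstance
  inner i := dualInnerProductSpace (X.H i)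
  finDim i := LinearEquiv.finiteDimensional
    (LinearMap.toContinuousLinearMap : (X.H i →ₗ[ℂ] ℂ) ≃ₗ[ℂ] StrongDual ℂ (X.H i))
  nontriv i := (InnerProductSpace.toDual ℂ (X.H i)).toEquiv.symm.nontrivial

/-! ### Relations of finite arity -/

/-- A relation of arity `(Γ 0, …, Γ (n-1))`: a space of functionals on
`X₀ ⊗ ⋯ ⊗ Xₙ₋₁`, that is, of multilinear functionals, for each choice of atoms `Xᵢ` of `Γ i`.
The order `≤`, the suprema, the infima, `⊤` and `⊥` are atomwise. -/
abbrev QRel {n : ℕ} (Γ : Fin n → QuantumSet.{u, v}) :=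
  (a : ∀ i, (Γ i).At) → Submodule ℂ (MultilinearMap ℂ (fun i => (Γ i).H (a i)) ℂ)

/-- The inner product of the Hilbert space `L(H₀ ⊗ ⋯ ⊗ Hₙ₋₁, ℂ)`, computed in the orthonormal
basis of elementary tensors of basis vectors. It does not depend on the bases: see
`functionalInner_eq`. -/
def functionalInner {n : ℕ} {H : Fin n → Type v} [∀ i, NormedAddCommGroup (H i)]
    [∀ i, InnerProductSpace ℂ (H i)] [∀ i, FiniteDimensional ℂ (H i)]
    (f g : MultilinearMap ℂ H ℂ) : ℂ :=
  ∑ k : ∀ i, Fin (Module.finrank ℂ (H i)),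
    starRingEnd ℂ (f fun i => stdOrthonormalBasis ℂ (H i) (k i)) *
      g fun i => stdOrthonormalBasis ℂ (H i) (k i)

theorem functionalInner_eq {n : ℕ} {H : Fin n → Type v} [∀ i, NormedAddCommGroup (H i)]
    [∀ i, InnerProductSpace ℂ (H i)] [∀ i, FiniteDimensional ℂ (H i)]
    {κ : Fin n → Type*} [∀ i, Fintype (κ i)] (b : ∀ i, OrthonormalBasis (κ i) ℂ (H i))
    (f g : MultilinearMap ℂ H ℂ) :
    functionalInner f g =
      ∑ k : ∀ i, κ i, starRingEnd ℂ (f fun i => b i (k i)) * g fun i => b i (k i) := by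
  classical
  have expand : ∀ (F : MultilinearMap ℂ H ℂ) (v : ∀ i, H i),
      F v = ∑ l : ∀ i, κ i, (∏ i, ⟪b i (l i), v i⟫_ℂ) * F fun i => b i (l i) := by
    intro F v
    have hv : v = fun i => ∑ j, ⟪b i j, v i⟫_ℂ • b i j :=
      funext fun i => ((b i).sum_repr' (v i)).symm
    conv_lhs => rw [hv]
    rw [MultilinearMap.map_sum]
    refine Finset.sum_congr rfl fun l _ => ?_
    rw [MultilinearMap.map_smul_univ, smul_eq_mul]
  have gram : ∀ l m : ∀ i, κ i,
      ∑ k : ∀ i, Fin (Module.finrank ℂ (H i)),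
        starRingEnd ℂ (∏ i, ⟪b i (l i), stdOrthonormalBasis ℂ (H i) (k i)⟫_ℂ) *
          ∏ i, ⟪b i (m i), stdOrthonormalBasis ℂ (H i) (k i)⟫_ℂ = if l = m then 1 else 0 := by
    intro l m
    have h1 : ∀ k : ∀ i, Fin (Module.finrank ℂ (H i)),
        starRingEnd ℂ (∏ i, ⟪b i (l i), stdOrthonormalBasis ℂ (H i) (k i)⟫_ℂ) *
          ∏ i, ⟪b i (m i), stdOrthonormalBasis ℂ (H i) (k i)⟫_ℂ =
        ∏ i, ⟪b i (m i), stdOrthonormalBasis ℂ (H i) (k i)⟫_ℂ *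
          ⟪stdOrthonormalBasis ℂ (H i) (k i), b i (l i)⟫_ℂ := by
      intro k
      rw [map_prod, ← Finset.prod_mul_distrib]
      refine Finset.prod_congr rfl fun i _ => ?_
      rw [inner_conj_symm, mul_comm]
    simp_rw [h1]
    rw [← Fintype.prod_sum fun i (j : Fin (Module.finrank ℂ (H i))) =>
      ⟪b i (m i), stdOrthonormalBasis ℂ (H i) j⟫_ℂ * ⟪stdOrthonormalBasis ℂ (H i) j, b i (l i)⟫_ℂ]
    simp_rw [OrthonormalBasis.sum_inner_mul_inner]
    split_ifs with h
    · subst h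
      simp
    · obtain ⟨i, hi⟩ := Function.ne_iff.1 h
      exact Finset.prod_eq_zero (Finset.mem_univ i)
        ((b i).orthonormal.inner_eq_zero (Ne.symm hi))
  have h2 : functionalInner f g = ∑ l : ∀ i, κ i, ∑ m : ∀ i, κ i,
      (starRingEnd ℂ (f fun i => b i (l i)) * g fun i => b i (m i)) *
      ∑ k : ∀ i, Fin (Module.finrank ℂ (H i)),
        starRingEnd ℂ (∏ i, ⟪b i (l i), stdOrthonormalBasis ℂ (H i) (k i)⟫_ℂ) *
          ∏ i, ⟪b i (m i), stdOrthonormalBasis ℂ (H i) (k i)⟫_ℂ := by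
    simp only [functionalInner]
    simp_rw [expand f fun i => stdOrthonormalBasis ℂ (H i) _,
      expand g fun i => stdOrthonormalBasis ℂ (H i) _, map_sum, Finset.sum_mul_sum, Finset.mul_sum]
    rw [Finset.sum_comm]
    refine Finset.sum_congr rfl fun l _ => ?_
    rw [Finset.sum_comm]
    refine Finset.sum_congr rfl fun m _ => Finset.sum_congr rfl fun k _ => ?_
    rw [map_mul]
    ring
  rw [h2]
  simp_rw [gram]
  simp

/-- The orthocomplement of a relation, atomwise. -/
def QRel.compl {n : ℕ} {Γ : Fin n → QuantumSet.{u, v}} (R : QRel Γ) : QRel Γ := fun a =>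
  { carrier := {g | ∀ f ∈ R a, functionalInner f g = 0}
    zero_mem' := fun f _ => by simp [functionalInner]
    add_mem' := fun {g h} hg hh f hf => by
      have h1 := hg f hf
      have h2 := hh f hf
      simp only [functionalInner] at h1 h2 ⊢
      simp only [add_apply, mul_add, Finset.sum_add_distrib, h1, h2, add_zero]
    smul_mem' := fun c g hg f hf => by
      have h1 := hg f hf
      simp only [functionalInner] at h1 ⊢
      simp only [smul_apply, smul_eq_mul, mul_left_comm _ c, ← Finset.mul_sum, h1,
        mul_zero] }

/-- For an injection `σ` and a relation `R` of arity `(Γ (σ 0), …, Γ (σ (m-1)))`, the relation of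
arity `(Γ 0, …, Γ (n-1))` that is obtained from `R × ⊤ × ⋯ × ⊤`, with one factor `⊤_{Γ i}` for each
`i` not of the form `σ k`, by permuting the tensor factors to their places. -/
def QRel.cylinder {m n : ℕ} {Γ : Fin n → QuantumSet.{u, v}} (σ : Fin m ↪ Fin n)
    (R : QRel fun k => Γ (σ k)) : QRel Γ := fun a =>
  Submodule.span ℂ {F | ∃ f ∈ R (fun k => a (σ k)), ∃ g : ∀ i, (Γ i).H (a i) →ₗ[ℂ] ℂ,
    ∀ v, F v = f (fun k => v (σ k)) * ∏ i with ∀ k, σ k ≠ i, g i (v i)}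

/-- The relation `⊤_X × R`. -/
def QRel.topProd {n : ℕ} {Γ : Fin n → QuantumSet.{u, v}} (X : QuantumSet.{u, v}) (R : QRel Γ) :
    QRel (Matrix.vecCons X Γ) :=
  QRel.cylinder (Γ := Matrix.vecCons X Γ) (Fin.succEmb n) R

/-! ### First-order formulas and their interpretation -/

/-- The primitive formulas in the context of variables `x₀ ∈ Γ 0, …, xₙ₋₁ ∈ Γ (n-1)`: atomic
formulas `R(x_{σ 0}, …, x_{σ (m-1)})` with distinct variables, negations, conjunctions and
universal quantifications. The newly bound variable is variable `0` in the scope of a quantifier,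
and the number of each other variable is larger by one there. -/
inductive QFormula : {n : ℕ} → (Fin n → QuantumSet.{u, v}) → Type (max (u + 1) (v + 1))
  | atom {n m : ℕ} {Γ : Fin n → QuantumSet.{u, v}} (σ : Fin m ↪ Fin n)
      (R : QRel fun k => Γ (σ k)) : QFormula Γ
  | neg {n : ℕ} {Γ : Fin n → QuantumSet.{u, v}} (φ : QFormula Γ) : QFormula Γ
  | and {n : ℕ} {Γ : Fin n → QuantumSet.{u, v}} (φ ψ : QFormula Γ) : QFormula Γ
  | all {n : ℕ} {Γ : Fin n → QuantumSet.{u, v}} (X : QuantumSet.{u, v})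
      (φ : QFormula (Matrix.vecCons X Γ)) : QFormula Γ

namespace QFormula

variable {n : ℕ} {Γ : Fin n → QuantumSet.{u, v}}

/-- The interpretation `⟦(x₀, …, xₙ₋₁) ∈ Γ 0 × ⋯ × Γ (n-1) | φ⟧`. -/
def interp : {n : ℕ} → {Γ : Fin n → QuantumSet.{u, v}} → QFormula Γ → QRel Γ
  | _, _, atom σ R => QRel.cylinder σ R
  | _, _, neg φ => (interp φ).compl
  | _, _, and φ ψ => interp φ ⊓ interp ψ
  | _, _, all X φ => sSup {R | QRel.topProd X R ≤ interp φ}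

/-- A sentence is true if its interpretation is the relation `⊤` of arity `()`. -/
def Holds (φ : QFormula (![] : Fin 0 → QuantumSet.{u, v})) : Prop := φ.interp = ⊤

def or (φ ψ : QFormula Γ) : QFormula Γ := neg (and (neg φ) (neg ψ))

/-- The Sasaki arrow. -/
def imp (φ ψ : QFormula Γ) : QFormula Γ := or (neg φ) (and φ ψ)

end QFormula

/-! ### Binary relations -/

/-- A binary relation from `X` to `Y`. -/
abbrev BinRel (X Y : QuantumSet.{u, v}) :=
  (a : X.At) → (b : Y.At) → Submodule ℂ (X.H a →L[ℂ] Y.H b)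

/-- A relation of arity `(X, Y)`, given by spaces of bilinear functionals. -/
abbrev BilinRel (X Y : QuantumSet.{u, v}) :=
  (a : X.At) → (b : Y.At) → Submodule ℂ (X.H a →ₗ[ℂ] Y.H b →ₗ[ℂ] ℂ)

/-- A bilinear functional as a multilinear functional of two variables. -/
def bilinToMultilin (M : Fin 2 → Type v) [∀ i, AddCommGroup (M i)] [∀ i, Module ℂ (M i)] :
    (M 0 →ₗ[ℂ] M 1 →ₗ[ℂ] ℂ) →ₗ[ℂ] MultilinearMap ℂ M ℂ where
  toFun f :=
    { toFun := fun v => f (v 0) (v 1)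
      map_update_add' := by
        intro _ w i x y
        fin_cases i <;> simp [Function.update]
      map_update_smul' := by
        intro _ w i c x
        fin_cases i <;> simp [Function.update] }
  map_add' f g := rfl
  map_smul' c f := rfl

def BilinRel.toRel {Δ : Fin 2 → QuantumSet.{u, v}} (R : BilinRel (Δ 0) (Δ 1)) : QRel Δ := fun a =>
  (R (a 0) (a 1)).map (bilinToMultilin fun i => (Δ i).H (a i))

/-- The atomic formula `R(xᵢ, xⱼ)`. -/
def QFormula.atom₂ {n : ℕ} {Γ : Fin n → QuantumSet.{u, v}} (i j : Fin n) (hij : i ≠ j)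
    (R : BilinRel (Γ i) (Γ j)) : QFormula Γ :=
  .atom ⟨![i, j], by
      intro k l h
      fin_cases k <;> fin_cases l <;> simp_all⟩
    (BilinRel.toRel (Δ := fun k => Γ (![i, j] k)) R)

/-- The equality relation `E_X` of arity `(X, X^*)`: the span of the evaluation functional on
`X₁ ⊗ X₁^*`, and zero on `X₁ ⊗ X₂^*` for distinct atoms `X₁` and `X₂`. -/
def equalityRel (X : QuantumSet.{u, v}) : BilinRel X X.dual := fun a b =>
  Submodule.span ℂ {f | ∃ h : a = b, ∀ (x : X.H a) (ξ : StrongDual ℂ (X.H b)), f x ξ = ξ (h ▸ x)}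

/-- For `r ∈ L(H, K)`, the functional `x ⊗ η ↦ η (r x)` on `H ⊗ K^*`. -/
def bendOp (H K : Type v) [NormedAddCommGroup H] [InnerProductSpace ℂ H]
    [NormedAddCommGroup K] [InnerProductSpace ℂ K] :
    (H →L[ℂ] K) →ₗ[ℂ] (H →ₗ[ℂ] StrongDual ℂ K →ₗ[ℂ] ℂ) where
  toFun r := LinearMap.mk₂ ℂ (fun x η => η (r x)) (by simp) (by simp) (by simp) (by simp)
  map_add' r s := by ext; simp
  map_smul' c r := by ext; simp

/-- For a binary relation `R` from `X` to `Y`, the relation `E_Y ∘ (R × I_{Y^*})` of arity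
`(X, Y^*)`. On `X₁ ⊗ Y₁^*`, it consists of the functionals `ε ∘ (r ⊗ 1)`, with `ε` the evaluation
functional on `Y₁ ⊗ Y₁^*`, for `r ∈ R(X₁, Y₁)`. -/
def BinRel.bend {X Y : QuantumSet.{u, v}} (R : BinRel X Y) : BilinRel X Y.dual := fun a b =>
  (R a b).map (bendOp (X.H a) (Y.H b))

/-- The conjugate `r_* = (r†)^* : H^* → K^*` of an operator `r : H → K`, that is,
`r_* ξ = ξ ∘ r†`. -/
def conjOp {H K : Type v} [NormedAddCommGroup H] [InnerProductSpace ℂ H] [CompleteSpace H]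
    [NormedAddCommGroup K] [InnerProductSpace ℂ K] [CompleteSpace K] (r : H →L[ℂ] K) :
    StrongDual ℂ H →L[ℂ] StrongDual ℂ K :=
  ContinuousLinearMap.precomp ℂ (ContinuousLinearMap.adjoint r)

/-- The conjugate `R_*`, a binary relation from `X^*` to `Y^*`. -/
def BinRel.conjugate {X Y : QuantumSet.{u, v}} (R : BinRel X Y) : BinRel X.dual Y.dual := fun a b =>
  Submodule.span ℂ (conjOp '' (R a b : Set (X.H a →L[ℂ] Y.H b)))

/-- For `s ∈ L(H, K^*)`, the functional `x ⊗ y ↦ (s x) y` on `H ⊗ K`. -/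
def bendDualOp (H K : Type v) [NormedAddCommGroup H] [NormedSpace ℂ H]
    [NormedAddCommGroup K] [NormedSpace ℂ K] :
    (H →L[ℂ] StrongDual ℂ K) →ₗ[ℂ] (H →ₗ[ℂ] K →ₗ[ℂ] ℂ) where
  toFun s := LinearMap.mk₂ ℂ (fun x y => s x y) (by simp) (by simp) (by simp) (by simp)
  map_add' r s := by ext; simp
  map_smul' c r := by ext; simp

/-- For a binary relation `S` from `X` to `Y^*`, the relation `E_{Y^*} ∘ (S × I_{Y^{**}})` of arity
`(X, Y^{**})`, where `Y^{**}` is identified with `Y`. -/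
def BinRel.bendDual {X Y : QuantumSet.{u, v}} (S : BinRel X Y.dual) : BilinRel X Y := fun a b =>
  (S a b).map (bendDualOp (X.H a) (Y.H b))

/-- The diagonal quantifier `(∀ (x = x_*) ∈ X × X^*) φ`, which abbreviates
`(∀ x_* ∈ X^*) (∀ x ∈ X) (E_X(x, x_*) → φ)`. In its scope, `x` is variable `0`, `x_*` is
variable `1`, and the number of each other variable is larger by two. -/
def QFormula.allDiag {n : ℕ} {Γ : Fin n → QuantumSet.{u, v}} (X : QuantumSet.{u, v})
    (φ : QFormula (Matrix.vecCons X (Matrix.vecCons X.dual Γ))) : QFormula Γ :=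
  all X.dual (all X (imp (atom₂ 0 1 (by simp) (equalityRel X)) φ))

namespace BinRel

variable {X : QuantumSet.{u, v}}

/-- `(∀ (x = x_*)) R̆(x, x_*)`. -/
def reflSentence (R : BinRel X X) : QFormula (![] : Fin 0 → QuantumSet.{u, v}) :=
  .allDiag X (.atom₂ 0 1 (by decide) R.bend)

/-- `(∀ (x₁ = x₁_*)) (∀ (x₂ = x₂_*)) (R̆(x₁, x₂_*) → R̆(x₂, x₁_*))`.
The variables `x₂, x₂_*, x₁, x₁_*` have the numbers `0, 1, 2, 3`. -/
def symmSentence (R : BinRel X X) : QFormula (![] : Fin 0 → QuantumSet.{u, v}) :=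
  .allDiag X (.allDiag X
    (.imp (.atom₂ 2 1 (by decide) R.bend) (.atom₂ 0 3 (by decide) R.bend)))

/-- `(∀ (x₁ = x₁_*)) (∀ (x₂ = x₂_*)) (∀ (x₃ = x₃_*))
((R̆(x₁, x₂_*) ∧ R̆(x₂, x₃_*)) → R̆_*(x₁_*, x₃))`.
The variables `x₃, x₃_*, x₂, x₂_*, x₁, x₁_*` have the numbers `0, 1, 2, 3, 4, 5`. -/
def transSentence (R : BinRel X X) : QFormula (![] : Fin 0 → QuantumSet.{u, v}) :=
  .allDiag X (.allDiag X (.allDiag X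
    (.imp (.and (.atom₂ 4 3 (by decide) R.bend) (.atom₂ 2 1 (by decide) R.bend))
      (.atom₂ 5 0 (by decide) R.conjugate.bendDual))))

end BinRel

/-! ### Operator algebras -/

namespace QuantumSet

variable (X : QuantumSet.{u, v})

/-- The Hilbert space `⨁ At(X)`, the `ℓ²`-direct sum of the atoms. -/
abbrev Hilb := lp X.H 2

open Classical in
/-- The inclusion isometry of an atom into `⨁ At(X)`. -/
def inc (i : X.At) : X.H i →L[ℂ] X.Hilb := lp.singleContinuousLinearMap ℂ X.H 2 i

theorem inc_apply_self (i : X.At) (x : X.H i) : X.inc i x i = x := by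
  simp [inc]

theorem inc_apply_ne {i j : X.At} (h : j ≠ i) (x : X.H i) : X.inc i x j = 0 := by
  simp [inc, h]

theorem inner_inc_left (i : X.At) (x : X.H i) (f : X.Hilb) : ⟪X.inc i x, f⟫_ℂ = ⟪x, f i⟫_ℂ := by
  classical
  simp only [inc, lp.singleContinuousLinearMap_apply]
  convert lp.inner_single_left i x f

theorem inner_inc_right (i : X.At) (x : X.H i) (f : X.Hilb) : ⟪f, X.inc i x⟫_ℂ = ⟪f i, x⟫_ℂ := by
  classical
  simp only [inc, lp.singleContinuousLinearMap_apply]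
  convert lp.inner_single_right i x f

theorem adjoint_inc_apply (i : X.At) (f : X.Hilb) : ContinuousLinearMap.adjoint (X.inc i) f = f i :=
  ext_inner_left ℂ fun x => by
    rw [ContinuousLinearMap.adjoint_inner_right, inner_inc_left]

/-- The operators on `⨁ At(X)` that act diagonally, by an operator on each atom. -/
def IsDiagonal (T : X.Hilb →L[ℂ] X.Hilb) : Prop :=
  ∃ t : ∀ i, X.H i →L[ℂ] X.H i, ∀ f i, T f i = t i (f i)

theorem isDiagonal_iff (T : X.Hilb →L[ℂ] X.Hilb) :
    X.IsDiagonal T ↔ ∀ i, (X.inc i ∘L ContinuousLinearMap.adjoint (X.inc i)) * T =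
      T * (X.inc i ∘L ContinuousLinearMap.adjoint (X.inc i)) := by
  constructor
  · rintro ⟨t, ht⟩ i
    ext f j
    simp only [mul_apply_eq_comp, ContinuousLinearMap.comp_apply, adjoint_inc_apply,
      ht]
    by_cases h : j = i
    · subst h
      rw [inc_apply_self, inc_apply_self]
    · rw [inc_apply_ne X h, inc_apply_ne X h, map_zero]
  · intro h
    refine ⟨fun i => ContinuousLinearMap.adjoint (X.inc i) ∘L T ∘L X.inc i, fun f i => ?_⟩
    have h1 := congrArg (fun S : X.Hilb →L[ℂ] X.Hilb => S f i) (h i)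
    simp only [mul_apply_eq_comp, ContinuousLinearMap.comp_apply, adjoint_inc_apply,
      inc_apply_self] at h1 ⊢
    exact h1

/-- The von Neumann algebra `ℓ^∞(X)`, the `ℓ^∞`-direct sum of the algebras `L(X₁)` for the atoms
`X₁` of `X`, canonically represented on `⨁ At(X)`. -/
def linfty : VonNeumannAlgebra X.Hilb where
  carrier := {T | X.IsDiagonal T}
  mul_mem' := by
    rintro S T ⟨s, hs⟩ ⟨t, ht⟩
    exact ⟨fun i => s i ∘L t i, fun f i => by simp [hs, ht]⟩
  add_mem' := by
    rintro S T ⟨s, hs⟩ ⟨t, ht⟩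
    exact ⟨fun i => s i + t i, fun f i => by simp [hs, ht]⟩
  algebraMap_mem' c := ⟨fun i => c • 1, fun f i => by simp [Algebra.algebraMap_eq_smul_one]⟩
  star_mem' := by
    rintro T ⟨t, ht⟩
    refine ⟨fun i => ContinuousLinearMap.adjoint (t i), fun f i => ext_inner_left ℂ fun x => ?_⟩
    rw [ContinuousLinearMap.star_eq_adjoint, ContinuousLinearMap.adjoint_inner_right,
      ← inner_inc_left, ContinuousLinearMap.adjoint_inner_right, ← inner_inc_left]
    congr 1
    ext j
    rw [ht]
    by_cases h : j = i
    · subst h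
      rw [inc_apply_self, inc_apply_self]
    · rw [inc_apply_ne X h, inc_apply_ne X h, map_zero]
  centralizer_centralizer' := by
    refine Set.Subset.antisymm (fun T hT => (X.isDiagonal_iff T).2 fun i => ?_)
      Set.subset_centralizer_centralizer
    exact hT _ fun S hS => ((X.isDiagonal_iff S).1 hS i).symm

/-- The family of spaces `inc_{X₂}† · V · inc_{X₁} ≤ L(X₁, X₂)`, for atoms `X₁` and `X₂` of `X`. -/
def compress (V : Submodule ℂ (X.Hilb →L[ℂ] X.Hilb)) : BinRel X X := fun a b =>
  V.map ((ContinuousLinearMap.postcomp (X.H a) (ContinuousLinearMap.adjoint (X.inc b)) ∘L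
    ContinuousLinearMap.precomp X.Hilb (X.inc a) :
      (X.Hilb →L[ℂ] X.Hilb) →L[ℂ] (X.H a →L[ℂ] X.H b)) :
      (X.Hilb →L[ℂ] X.Hilb) →ₗ[ℂ] (X.H a →L[ℂ] X.H b))

end QuantumSet

section

variable {H : Type u} [NormedAddCommGroup H] [InnerProductSpace ℂ H] [CompleteSpace H]

/-- The ultraweak topology on `L(H)`: the coarsest topology for which the functionals
`T ↦ ∑ₙ ⟪xₙ, T yₙ⟫` with `∑ₙ ‖xₙ‖² < ∞` and `∑ₙ ‖yₙ‖² < ∞` are continuous. -/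
@[reducible]
def ultraweakTopology (H : Type u) [NormedAddCommGroup H] [InnerProductSpace ℂ H] :
    TopologicalSpace (H →L[ℂ] H) :=
  ⨅ (x : lp (fun _ : ℕ => H) 2) (y : lp (fun _ : ℕ => H) 2),
    TopologicalSpace.induced (fun T => ∑' n, ⟪x n, T (y n)⟫_ℂ) inferInstance

/-- A quantum preorder on a von Neumann algebra `M ⊆ L(H)` is an ultraweakly closed algebra
`V ⊆ L(H)` that contains the commutant of `M`. -/
structure IsQuantumPreorder (M : VonNeumannAlgebra H) (V : Subalgebra ℂ (H →L[ℂ] H)) : Prop where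
  isClosed : IsClosed[ultraweakTopology H] (V : Set (H →L[ℂ] H))
  commutant_le : (M.commutant : Set (H →L[ℂ] H)) ⊆ V

/-- A von Neumann algebra as a subspace of `L(H)`. -/
def VonNeumannAlgebra.toSubmodule (M : VonNeumannAlgebra H) : Submodule ℂ (H →L[ℂ] H) :=
  Subalgebra.toSubmodule M.toStarSubalgebra.toSubalgebra

end

end

open scoped InnerProductSpace Topology

noncomputable section

/-! The proof has a logical half, which turns each sentence into an algebraic condition on the
spaces `R a b`, and an operator-algebraic half, which matches such families of spaces with algebras.

Logic. A functional `t` lies in `φ → ψ` exactly when its projection onto `φ` lies in `ψ`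
(`mem_imp_iff`). A product functional on `X ⊗ X^*` projects onto a multiple of the evaluation
functional `ε`, so a diagonal quantifier tests its formula on `ε ⊗ f` alone (`mem_allDiag_iff`). In
the empty context the functionals are scalars, so a sentence with diagonal quantifiers in front is
true iff products of `ε`'s lie in the matrix formula. Since `ε` is the bent identity, reflexivity
says that `1 ∈ R a a`. For the other two sentences, a Hilbert-Schmidt orthonormal basis `rₖ` of `R a
b` makes the projection explicit: `ξ₂(x₂) ξ₁(x₁)` projects onto `∑ ξ₂(rₖ x₁) ξ₁(rₖ† x₂)`. Linear
independence of the `rₖ` separates the terms, so the consequent holds iff each `rₖ†` lies in `R b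
a`. In the same way, with a basis `sₗ` of `R b c`, transitivity reduces to `sₗ rₖ ∈ R a c`.

Operators. A quantum preorder `V` contains the projections onto the atoms, as these commute with
`ℓ^∞(X)`. Hence the truncation to finitely many atoms of an operator whose blocks come from `V` lies
in `V`; truncations converge ultraweakly, so `V` consists of all operators with blocks in `compress
V` (`ofBinRel_compress`). Conversely, the operators with blocks in `R` form an ultraweakly closed
space, because atoms are finite-dimensional; reflexivity puts the commutant of `ℓ^∞(X)` into it, and
transitivity makes it an algebra.

For part (b), `M ↦ M'` embeds the subalgebras of `ℓ^∞(X)` into the quantum preorders, and symmetry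
expresses closure under adjoints. The *-algebra built from `R` is its own double commutant: by the
density argument of von Neumann, a double commutant element is approximated on the finitely many
basis vectors that determine a block (`evalFamily_mem_closure`, `block_mem_of_mem_centralizer`). -/

/-! ### Multilinear functionals -/

/-- The multilinear functional `v ↦ f (v ∘ σ) * ∏ gᵢ (vᵢ)`, the product ranging over the indices
that are not in the range of `σ`. -/
def mulProd {m n : ℕ} {M : Fin n → Type*} [∀ i, AddCommGroup (M i)] [∀ i, Module ℂ (M i)]
    (σ : Fin m ↪ Fin n) (f : MultilinearMap ℂ (fun k => M (σ k)) ℂ) (g : ∀ i, M i →ₗ[ℂ] ℂ) :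
    MultilinearMap ℂ M ℂ :=
  have aux : ∀ (v : ∀ i, M i) (i : Fin n), ∃ L : M i →ₗ[ℂ] ℂ, ∀ x : M i,
      f (fun k => Function.update v i x (σ k)) *
        ∏ j with ∀ k, σ k ≠ j, g j (Function.update v i x j) = L x := by
    intro v i
    by_cases hi : ∃ k, σ k = i
    · obtain ⟨k, rfl⟩ := hi
      refine ⟨(∏ j with ∀ k, σ k ≠ j, g j (v j)) • f.toLinearMap (fun k => v (σ k)) k, fun x => ?_⟩
      rw [Function.update_comp_eq_of_injective' v σ.injective]
      simp only [LinearMap.smul_apply, MultilinearMap.toLinearMap_apply, smul_eq_mul]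
      rw [mul_comm]
      congr 1
      refine Finset.prod_congr rfl fun j hj => ?_
      rw [Function.update_of_ne ((Finset.mem_filter.1 hj).2 k).symm]
    · push Not at hi
      refine ⟨(f (fun k => v (σ k)) * ∏ j ∈ (Finset.univ.filter fun j => ∀ k, σ k ≠ j).erase i,
        g j (v j)) • g i, fun x => ?_⟩
      rw [Function.update_comp_eq_of_forall_ne' v x hi,
        ← Finset.prod_erase_mul _ _ (Finset.mem_filter.2 ⟨Finset.mem_univ i, hi⟩)]
      simp only [LinearMap.smul_apply, smul_eq_mul, Function.update_self, mul_assoc]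
      congr 2
      refine Finset.prod_congr rfl fun j hj => ?_
      rw [Function.update_of_ne (Finset.ne_of_mem_erase hj)]
  { toFun := fun v => f (fun k => v (σ k)) * ∏ i with ∀ k, σ k ≠ i, g i (v i)
    map_update_add' := by
      intro hd v i x y
      obtain rfl : hd = instDecidableEqFin n := Subsingleton.elim _ _
      obtain ⟨L, hL⟩ := aux v i
      rw [hL, hL, hL, map_add]
    map_update_smul' := by
      intro hd v i c x
      obtain rfl : hd = instDecidableEqFin n := Subsingleton.elim _ _
      obtain ⟨L, hL⟩ := aux v i
      rw [hL, hL, map_smul] }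

theorem mulProd_apply {m n : ℕ} {M : Fin n → Type*} [∀ i, AddCommGroup (M i)]
    [∀ i, Module ℂ (M i)] (σ : Fin m ↪ Fin n) (f : MultilinearMap ℂ (fun k => M (σ k)) ℂ)
    (g : ∀ i, M i →ₗ[ℂ] ℂ) (v : ∀ i, M i) :
    mulProd σ f g v = f (fun k => v (σ k)) * ∏ i with ∀ k, σ k ≠ i, g i (v i) := rfl

/-- A multilinear functional, expanded in the variables in a set `s` along orthonormal bases. -/
theorem MultilinearMap.eq_sum_of_orthonormalBasis {n : ℕ} {M : Fin n → Type*}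
    [∀ i, NormedAddCommGroup (M i)] [∀ i, InnerProductSpace ℂ (M i)] {κ : Fin n → Type*}
    [∀ i, Fintype (κ i)] [∀ i, Nonempty (κ i)] (b : ∀ i, OrthonormalBasis (κ i) ℂ (M i))
    (F : MultilinearMap ℂ M ℂ) (s : Fin n → Prop) [DecidablePred s] :
    ∃ A : Finset (∀ i, κ i), ∀ v : ∀ i, M i, F v = ∑ r ∈ A, (∏ i with s i, ⟪b i (r i), v i⟫_ℂ) *
      F fun i => if s i then b i (r i) else v i := by
  classical
  -- Variables outside `s` get a single dummy index with coefficient `1`, so that one multilinear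
  -- expansion covers both kinds of variables.
  refine ⟨Fintype.piFinset fun i => if s i then Finset.univ else {Classical.arbitrary (κ i)},
    fun v => ?_⟩
  have hv : v = fun i => ∑ j ∈ (if s i then Finset.univ else {Classical.arbitrary (κ i)}),
      (if s i then ⟪b i j, v i⟫_ℂ else 1) • (if s i then b i j else v i) := by
    funext i
    by_cases hi : s i
    · simp only [hi, if_true]
      exact ((b i).sum_repr' (v i)).symm
    · simp [hi]
  conv_lhs => rw [hv]
  rw [MultilinearMap.map_sum_finset]
  refine Finset.sum_congr rfl fun r _ => ?_
  rw [MultilinearMap.map_smul_univ, smul_eq_mul, Finset.prod_filter]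

/-! ### Cylinders and their orthocomplements -/

namespace QRel

variable {m n : ℕ} {Γ : Fin n → QuantumSet.{u, v}}

theorem mulProd_mem_cylinder (σ : Fin m ↪ Fin n) {R : QRel fun k => Γ (σ k)}
    {a : ∀ i, (Γ i).At} {f : MultilinearMap ℂ (fun k => (Γ (σ k)).H (a (σ k))) ℂ}
    (hf : f ∈ R fun k => a (σ k)) (g : ∀ i, (Γ i).H (a i) →ₗ[ℂ] ℂ) :
    mulProd (M := fun i => (Γ i).H (a i)) σ f g ∈ QRel.cylinder σ R a :=
  Submodule.subset_span ⟨f, hf, g, fun _ => rfl⟩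

/-- A functional is in a cylinder if and only if its slices are in the base. -/
theorem mem_cylinder_iff (σ : Fin m ↪ Fin n) {R : QRel fun k => Γ (σ k)} {a : ∀ i, (Γ i).At}
    {F : MultilinearMap ℂ (fun i => (Γ i).H (a i)) ℂ} :
    F ∈ QRel.cylinder σ R a ↔ ∀ w : ∀ i, (Γ i).H (a i), ∃ f ∈ R (fun k => a (σ k)),
      ∀ v : ∀ i, (Γ i).H (a i), (∀ i, (∀ k, σ k ≠ i) → v i = w i) → F v = f fun k => v (σ k) := by
  classical
  constructor
  · intro hF w
    induction hF using Submodule.span_induction with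
    | mem F hF =>
      obtain ⟨f, hf, g, h⟩ := hF
      refine ⟨(∏ i with ∀ k, σ k ≠ i, g i (w i)) • f, Submodule.smul_mem _ _ hf, fun v hv => ?_⟩
      rw [h, smul_apply, smul_eq_mul, mul_comm]
      congr 1
      exact Finset.prod_congr rfl fun i hi => by rw [hv i (Finset.mem_filter.1 hi).2]
    | zero => exact ⟨0, Submodule.zero_mem _, fun v _ => rfl⟩
    | add F G _ _ hF hG =>
      obtain ⟨f, hf, hf'⟩ := hF
      obtain ⟨g, hg, hg'⟩ := hG
      exact ⟨f + g, Submodule.add_mem _ hf hg, fun v hv => by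
        rw [add_apply, add_apply, hf' v hv, hg' v hv]⟩
    | smul c F _ hF =>
      obtain ⟨f, hf, hf'⟩ := hF
      exact ⟨c • f, Submodule.smul_mem _ _ hf, fun v hv => by
        rw [smul_apply, smul_apply, hf' v hv]⟩
  · intro h
    -- Atoms are nonzero, which supplies the dummy index of the expansion.
    have hne : ∀ i, Nonempty (Fin (Module.finrank ℂ ((Γ i).H (a i)))) := fun i =>
      ⟨⟨0, Module.finrank_pos⟩⟩
    let b := fun i => stdOrthonormalBasis ℂ ((Γ i).H (a i))
    obtain ⟨A, hA⟩ := F.eq_sum_of_orthonormalBasis b fun i => ∀ k, σ k ≠ i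
    choose f hf hfv using fun r : ∀ i, Fin (Module.finrank ℂ ((Γ i).H (a i))) =>
      h fun i => b i (r i)
    -- Expanded along bases of the variables outside the range of `σ`, `F` has its slices at basis
    -- vectors as coefficients, and these lie in `R` by assumption.
    have hF : F = ∑ r ∈ A, mulProd (M := fun i => (Γ i).H (a i)) σ (f r)
        fun i => (innerSL ℂ (b i (r i))).toLinearMap := by
      ext v
      rw [hA v, sum_apply]
      refine Finset.sum_congr rfl fun r _ => ?_
      rw [mulProd_apply, mul_comm, hfv r _ fun i hi => if_pos hi]
      congr 2
      funext k
      exact if_neg fun h => h k rfl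
    rw [hF]
    exact Submodule.sum_mem _ fun r _ => mulProd_mem_cylinder σ (hf r) _

/-- Summing over the variables in the range of `σ` before the others, the inner product of a
generator `f ⊗ ∏ gᵢ` with `G` becomes a sum of multiples of inner products of `f` with slices of
`G`, and these slices are orthogonal to `R`. -/
theorem cylinder_compl_le (σ : Fin m ↪ Fin n) (R : QRel fun k => Γ (σ k)) :
    QRel.cylinder σ R.compl ≤ (QRel.cylinder σ R).compl := by
  classical
  intro a G hG F hF
  induction hF using Submodule.span_induction with
  | zero => simp [functionalInner]
  | add F F' _ _ h h' =>
    simp only [functionalInner] at h h' ⊢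
    simp only [add_apply, map_add, add_mul, Finset.sum_add_distrib, h, h', add_zero]
  | smul c F _ h =>
    simp only [functionalInner] at h ⊢
    simp only [smul_apply, smul_eq_mul, map_mul, mul_assoc, ← Finset.mul_sum, h,
      mul_zero]
  | mem F hF =>
    obtain ⟨f, hf, g, hF⟩ := hF
    rw [mem_cylinder_iff] at hG
    let b := fun i => stdOrthonormalBasis ℂ ((Γ i).H (a i))
    let κ : Fin n → Type := fun i => Fin (Module.finrank ℂ ((Γ i).H (a i)))
    let e := Equiv.ofInjective σ σ.injective
    let E := Equiv.piCongrLeft (fun x : Set.range σ => κ x) e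
    let D := (Equiv.piEquivPiSubtypeProd (fun i => i ∈ Set.range σ) κ).symm
    have hD : ∀ x i, (hi : i ∈ Set.range σ) → D x i = x.1 ⟨i, hi⟩ := fun x i hi => dif_pos hi
    have hD' : ∀ x i, (hi : i ∉ Set.range σ) → D x i = x.2 ⟨i, hi⟩ := fun x i hi => dif_neg hi
    rw [functionalInner, ← D.sum_comp, Fintype.sum_prod_type_right]
    refine Finset.sum_eq_zero fun y _ => ?_
    rw [← E.sum_comp]
    have hσ : ∀ l k, D (E l, y) (σ k) = l k := fun l k => by
      rw [hD _ _ ⟨k, rfl⟩]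
      exact Equiv.piCongrLeft_apply_apply (fun x : Set.range σ => κ x) e l k
    -- The index `l₀` serves only to name the vectors outside the range of `σ`; by `hnot` they do
    -- not depend on it.
    rcases isEmpty_or_nonempty (∀ k, κ (σ k)) with hempty | ⟨⟨l₀⟩⟩
    · exact Finset.sum_eq_zero fun l _ => hempty.elim l
    obtain ⟨G', hG', hG''⟩ := hG fun i => b i (D (E l₀, y) i)
    have hnot : ∀ l i, (∀ k, σ k ≠ i) → D (E l, y) i = D (E l₀, y) i := fun l i hi => by
      have hi' : i ∉ Set.range σ := fun ⟨k, hk⟩ => hi k hk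
      rw [hD' _ _ hi', hD' _ _ hi']
    have hsum := hG' f hf
    calc _ = ∑ l : ∀ k, κ (σ k), starRingEnd ℂ (∏ i with ∀ k, σ k ≠ i, g i (b i (D (E l₀, y) i))) *
          (starRingEnd ℂ (f fun k => b (σ k) (l k)) * G' fun k => b (σ k) (l k)) := by
          refine Finset.sum_congr rfl fun l _ => ?_
          have h1 : ∏ i with ∀ k, σ k ≠ i, g i (b i (D (E l, y) i)) =
              ∏ i with ∀ k, σ k ≠ i, g i (b i (D (E l₀, y) i)) :=
            Finset.prod_congr rfl fun i hi => by rw [hnot l i (Finset.mem_filter.1 hi).2]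
          have h2 := hG'' (fun i => b i (D (E l, y) i)) fun i hi => by rw [hnot l i hi]
          have h3 : (fun k => b (σ k) (D (E l, y) (σ k))) = fun k => b (σ k) (l k) :=
            funext fun k => by rw [hσ]
          rw [hF]
          change starRingEnd ℂ (f (fun k => b (σ k) (D (E l, y) (σ k))) *
            ∏ i with ∀ k, σ k ≠ i, g i (b i (D (E l, y) i))) *
              G (fun i => b i (D (E l, y) i)) = _
          rw [h1, h2, h3, map_mul]
          ring
      _ = 0 := by
          rw [← Finset.mul_sum]
          exact mul_eq_zero_of_right _ hsum

end QRel

/-! ### The Hilbert space of multilinear functionals -/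

section

variable {n : ℕ} {H : Fin n → Type v} [∀ i, NormedAddCommGroup (H i)]
  [∀ i, InnerProductSpace ℂ (H i)] [∀ i, FiniteDimensional ℂ (H i)]

/-- `functionalInner` is an inner product. -/
@[reducible]
def functionalInnerCore : InnerProductSpace.Core ℂ (MultilinearMap ℂ H ℂ) where
  inner := functionalInner
  conj_inner_symm f g := by
    simp only [functionalInner, map_sum, map_mul, Complex.conj_conj, mul_comm]
  re_inner_nonneg f := by
    simp only [functionalInner, map_sum]
    refine Finset.sum_nonneg fun k _ => ?_
    rw [mul_comm, RCLike.mul_conj]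
    norm_cast
    positivity
  add_left f g h := by
    simp only [functionalInner, add_apply, map_add, add_mul, Finset.sum_add_distrib]
  smul_left f g c := by
    simp only [functionalInner, smul_apply, smul_eq_mul, map_mul, mul_assoc, Finset.mul_sum]
  definite f hf := by
    have h : ∀ k : ∀ i, Fin (Module.finrank ℂ (H i)), f (fun i => stdOrthonormalBasis ℂ (H i) (k i)) = 0 := by
      have h1 : ∑ k : ∀ i, Fin (Module.finrank ℂ (H i)),
          ‖f fun i => stdOrthonormalBasis ℂ (H i) (k i)‖ ^ 2 = 0 := by
        have h2 : ((∑ k : ∀ i, Fin (Module.finrank ℂ (H i)),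
          ‖f fun i => stdOrthonormalBasis ℂ (H i) (k i)‖ ^ 2 : ℝ) : ℂ) = 0 := by
          rw [← hf, functionalInner]
          push_cast
          exact Finset.sum_congr rfl fun k _ => (Complex.conj_mul' _).symm
        exact_mod_cast h2
      intro k
      have := (Finset.sum_eq_zero_iff_of_nonneg fun k _ => by positivity).1 h1 k (Finset.mem_univ k)
      simpa using this
    refine Module.Basis.ext_multilinear (fun i => (stdOrthonormalBasis ℂ (H i)).toBasis)
      fun k => ?_
    simpa using h k

/-- The Hilbert space norm of multilinear functionals. -/
@[reducible]
def functionalNormed : NormedAddCommGroup (MultilinearMap ℂ H ℂ) :=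
  (functionalInnerCore (H := H)).toNormedAddCommGroup

/-- The Hilbert space structure of multilinear functionals. -/
@[reducible]
def functionalInnerProductSpace :
    letI := functionalNormed (H := H)
    InnerProductSpace ℂ (MultilinearMap ℂ H ℂ) :=
  InnerProductSpace.ofCore (functionalInnerCore (H := H)).toCore

/-- A space of multilinear functionals has an orthonormal basis. -/
theorem exists_functional_frame (S : Submodule ℂ (MultilinearMap ℂ H ℂ)) :
    ∃ (d : ℕ) (e : Fin d → MultilinearMap ℂ H ℂ), (∀ k, e k ∈ S) ∧
      (∀ k l, functionalInner (e k) (e l) = if k = l then 1 else 0) ∧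
      (∀ f, ∀ g ∈ S, functionalInner g (f - ∑ k, functionalInner (e k) f • e k) = 0) ∧
      ∀ f ∈ S, f = ∑ k, functionalInner (e k) f • e k := by
  let := functionalNormed (H := H)
  let := functionalInnerProductSpace (H := H)
  have hfin : FiniteDimensional ℂ (MultilinearMap ℂ H ℂ) := Module.Finite.multilinearMap
  let b := stdOrthonormalBasis ℂ S
  refine ⟨_, fun k => (b k : MultilinearMap ℂ H ℂ), fun k => (b k).2, fun k l => ?_,
    fun f g hg => ?_, fun f hf => ?_⟩
  · exact (orthonormal_iff_ite.1 b.orthonormal k l)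
  · have h1 : ∑ k, functionalInner (b k : MultilinearMap ℂ H ℂ) f • (b k : MultilinearMap ℂ H ℂ) =
        S.starProjection f := by
      rw [b.starProjection_eq_sum_rankOne]
      simp [InnerProductSpace.rankOne_apply]
      rfl
    rw [h1]
    exact (Submodule.sub_starProjection_mem_orthogonal f) g hg
  · have := congrArg Subtype.val (b.sum_repr' ⟨f, hf⟩)
    refine this.symm.trans ?_
    simp
    rfl

end

/-! ### The Sasaki arrow -/

namespace QRel

variable {n : ℕ} {Γ : Fin n → QuantumSet.{u, v}}

/-- The left side is what `¬φ ∨ (φ ∧ ψ)` unfolds to. At each choice of atoms `compl` is the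
orthogonal complement in a finite-dimensional Hilbert space, so De Morgan and double complementation
apply. -/
theorem compl_sasaki (A B : QRel Γ) (a : ∀ i, (Γ i).At) :
    (A.compl.compl ⊓ (A ⊓ B).compl).compl a = A.compl a ⊔ (A a ⊓ B a) := by
  let := functionalNormed (H := fun i => (Γ i).H (a i))
  let := functionalInnerProductSpace (H := fun i => (Γ i).H (a i))
  have hfin : FiniteDimensional ℂ (MultilinearMap ℂ (fun i => (Γ i).H (a i)) ℂ) :=
    Module.Finite.multilinearMap
  have h1 : ∀ C : QRel Γ, C.compl a = (C a)ᗮ := fun C => rfl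
  rw [h1, Pi.inf_apply, h1, h1, h1, Submodule.inf_orthogonal, Submodule.orthogonal_orthogonal]
  rfl

theorem eq_zero_of_mem_compl (A : QRel Γ) (a : ∀ i, (Γ i).At)
    {f : MultilinearMap ℂ (fun i => (Γ i).H (a i)) ℂ} (h : f ∈ A a) (h' : f ∈ A.compl a) : f = 0 :=
  functionalInnerCore.definite f (h' f h)

end QRel

namespace QFormula

variable {n : ℕ} {Γ : Fin n → QuantumSet.{u, v}}

/-- The Sasaki arrow tests the projection onto the antecedent. -/
theorem mem_imp_iff {φ ψ : QFormula Γ} {a : ∀ i, (Γ i).At}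
    {t p : MultilinearMap ℂ (fun i => (Γ i).H (a i)) ℂ} (hp : p ∈ φ.interp a)
    (ht : t - p ∈ φ.interp.compl a) : t ∈ (imp φ ψ).interp a ↔ p ∈ ψ.interp a := by
  have h : (imp φ ψ).interp a = φ.interp.compl a ⊔ (φ.interp a ⊓ ψ.interp a) :=
    QRel.compl_sasaki _ _ a
  rw [h]
  constructor
  · intro ht'
    obtain ⟨q, hq, r, hr, rfl⟩ := Submodule.mem_sup.1 ht'
    -- Both `r` and `p` are the component of `t` in the antecedent: their difference lies in it and
    -- in its orthocomplement, hence vanishes.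
    have h1 : r - p ∈ φ.interp.compl a := by
      have := Submodule.sub_mem _ ht hq
      rwa [show q + r - p - q = r - p by abel] at this
    have h2 := QRel.eq_zero_of_mem_compl _ a (Submodule.sub_mem _ hr.1 hp) h1
    rw [← sub_eq_zero.1 h2]
    exact hr.2
  · intro hp'
    have h1 : p ∈ φ.interp a ⊓ ψ.interp a := ⟨hp, hp'⟩
    have := Submodule.add_mem_sup ht h1
    rwa [sub_add_cancel] at this

end QFormula

/-! ### Quantifiers -/

section

variable {n : ℕ} {Γ : Fin n → QuantumSet.{u, v}}

/-- A choice of atoms for a context with an additional first variable. -/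
abbrev consAtoms {X : QuantumSet.{u, v}} (i : X.At) (a : ∀ k, (Γ k).At) :
    ∀ k, (Matrix.vecCons X Γ k).At :=
  Fin.cons (α := fun k => (Matrix.vecCons X Γ k).At) i a

theorem exists_eq_consAtoms {X : QuantumSet.{u, v}} (a' : ∀ k, (Matrix.vecCons X Γ k).At) :
    ∃ (i : X.At) (a : ∀ k, (Γ k).At), a' = consAtoms i a :=
  ⟨a' 0, fun k => a' k.succ, (Fin.cons_self_tail (α := fun k => (Matrix.vecCons X Γ k).At) a').symm⟩

/-- Functionals on `X_i ⊗ X_a` for an additional first variable. -/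
abbrev ConsFunctional {X : QuantumSet.{u, v}} (i : X.At) (a : ∀ k, (Γ k).At) :=
  MultilinearMap ℂ (fun k => (Matrix.vecCons X Γ k).H (consAtoms i a k)) ℂ

/-- The functional `g ⊗ f`. -/
def consMul {X : QuantumSet.{u, v}} {i : X.At} {a : ∀ k, (Γ k).At} (g : X.H i →ₗ[ℂ] ℂ)
    (f : MultilinearMap ℂ (fun k => (Γ k).H (a k)) ℂ) : ConsFunctional i a :=
  mulProd (M := fun k => (Matrix.vecCons X Γ k).H (consAtoms i a k)) (Fin.succEmb n) f
    -- The zeros in the tail are never evaluated: only index `0` is outside the range of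
    -- `Fin.succEmb`.
    (Fin.cons (α := fun k => (Matrix.vecCons X Γ k).H (consAtoms i a k) →ₗ[ℂ] ℂ) g 0)

theorem Fin.filter_succ_ne (n : ℕ) :
    (Finset.univ.filter fun i : Fin (n + 1) => ∀ k, Fin.succEmb n k ≠ i) = {0} := by
  ext i
  simp only [Finset.mem_filter, Finset.mem_univ, true_and, Finset.mem_singleton]
  constructor
  · intro h
    by_contra hi
    exact h (i.pred hi) (Fin.succ_pred i hi)
  · rintro rfl k
    exact Fin.succ_ne_zero k

theorem consMul_apply {X : QuantumSet.{u, v}} {i : X.At} {a : ∀ k, (Γ k).At}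
    (g : X.H i →ₗ[ℂ] ℂ) (f : MultilinearMap ℂ (fun k => (Γ k).H (a k)) ℂ)
    (v : ∀ k, (Matrix.vecCons X Γ k).H (consAtoms i a k)) :
    consMul g f v = g (v 0) * f fun k => v k.succ := by
  change (f fun k => v k.succ) * ∏ j : Fin (n + 1) with ∀ k, Fin.succEmb n k ≠ j,
    Fin.cons (α := fun k => (Matrix.vecCons X Γ k).H (consAtoms i a k) →ₗ[ℂ] ℂ) g 0 j (v j) = _
  rw [Fin.filter_succ_ne, Finset.prod_singleton, mul_comm]
  rfl

theorem consMul_add {X : QuantumSet.{u, v}} {i : X.At} {a : ∀ k, (Γ k).At}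
    (g : X.H i →ₗ[ℂ] ℂ) (f f' : MultilinearMap ℂ (fun k => (Γ k).H (a k)) ℂ) :
    consMul g (f + f') = consMul g f + consMul g f' := by
  ext v
  rw [add_apply, consMul_apply, consMul_apply, consMul_apply, ← mul_add]
  rfl

theorem consMul_smul {X : QuantumSet.{u, v}} {i : X.At} {a : ∀ k, (Γ k).At}
    (g : X.H i →ₗ[ℂ] ℂ) (c : ℂ) (f : MultilinearMap ℂ (fun k => (Γ k).H (a k)) ℂ) :
    consMul g (c • f) = c • consMul g f := by
  ext v
  rw [smul_apply, consMul_apply, consMul_apply, smul_eq_mul, mul_left_comm]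
  rfl

namespace QFormula

/-- The supremum is attained. The functionals that pass the test on the right form a relation `P`;
since `⊤ × P` is spanned by the products `g ⊗ f`, it lies below `φ`, and every competitor lies below
`P`. -/
theorem mem_all_iff {X : QuantumSet.{u, v}} {φ : QFormula (Matrix.vecCons X Γ)}
    {a : ∀ k, (Γ k).At} {f : MultilinearMap ℂ (fun k => (Γ k).H (a k)) ℂ} :
    f ∈ (all X φ).interp a ↔
      ∀ (i : X.At) (g : X.H i →ₗ[ℂ] ℂ), consMul g f ∈ φ.interp (consAtoms i a) := by
  let P : QRel Γ := fun a =>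
    { carrier := {f | ∀ (i : X.At) (g : X.H i →ₗ[ℂ] ℂ), consMul g f ∈ φ.interp (consAtoms i a)}
      zero_mem' := fun i g => by
        rw [← zero_smul ℂ (0 : MultilinearMap ℂ (fun k => (Γ k).H (a k)) ℂ), consMul_smul, zero_smul]
        exact Submodule.zero_mem _
      add_mem' := fun {f f'} h h' i g => by
        rw [consMul_add]
        exact Submodule.add_mem _ (h i g) (h' i g)
      smul_mem' := fun c f h i g => by
        rw [consMul_smul]
        exact Submodule.smul_mem _ _ (h i g) }
  have hP : sSup {R | QRel.topProd X R ≤ φ.interp} = P := by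
    apply le_antisymm
    · refine sSup_le fun R hR a f hf i g => hR _ ?_
      exact QRel.mulProd_mem_cylinder (Γ := Matrix.vecCons X Γ) (Fin.succEmb n) hf _
    · refine le_sSup fun a' => ?_
      obtain ⟨i, a, rfl⟩ := exists_eq_consAtoms a'
      refine Submodule.span_le.2 ?_
      rintro F ⟨f, hf, g, hF⟩
      have : F = consMul (X := X) (g 0) f := by
        ext v
        refine (hF v).trans (Eq.trans ?_
          (consMul_apply (X := X) (i := i) (a := a) (g 0) f v).symm)
        rw [Fin.filter_succ_ne, Finset.prod_singleton, mul_comm]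
        rfl
      rw [this]
      exact hf i (g 0)
  change f ∈ (sSup {R | QRel.topProd X R ≤ φ.interp}) a ↔ _
  rw [hP]
  rfl

/-- The atomic formula `R(xᵢ, xⱼ)` is tested by fixing the other variables. -/
theorem mem_atom₂_iff {i j : Fin n} (hij : i ≠ j) {R : BilinRel (Γ i) (Γ j)}
    {a : ∀ k, (Γ k).At} {F : MultilinearMap ℂ (fun k => (Γ k).H (a k)) ℂ} :
    F ∈ (atom₂ i j hij R).interp a ↔ ∀ w : ∀ k, (Γ k).H (a k), ∃ f ∈ R (a i) (a j),
      ∀ v : ∀ k, (Γ k).H (a k), (∀ k, k ≠ i → k ≠ j → v k = w k) → F v = f (v i) (v j) := by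
  refine QRel.mem_cylinder_iff _ |>.trans (forall_congr' fun w => ?_)
  constructor
  · rintro ⟨_, ⟨f, hf, rfl⟩, h⟩
    refine ⟨f, hf, fun v hv => h v fun k hk => hv k ?_ ?_⟩
    · rintro rfl
      exact hk 0 rfl
    · rintro rfl
      exact hk 1 rfl
  · rintro ⟨f, hf, h⟩
    refine ⟨_, ⟨f, hf, rfl⟩, fun v hv => h v fun k hi hj => hv k fun l => ?_⟩
    fin_cases l
    · exact hi.symm
    · exact hj.symm

/-- The orthocomplement of the atomic formula `R(xᵢ, xⱼ)` is tested by fixing the other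
variables. -/
theorem mem_compl_atom₂ {i j : Fin n} (hij : i ≠ j) {R : BilinRel (Γ i) (Γ j)}
    {a : ∀ k, (Γ k).At} {F : MultilinearMap ℂ (fun k => (Γ k).H (a k)) ℂ}
    (h : ∀ w : ∀ k, (Γ k).H (a k), ∃ f : (Γ i).H (a i) →ₗ[ℂ] (Γ j).H (a j) →ₗ[ℂ] ℂ,
      (∀ e ∈ R (a i) (a j),
        functionalInner (bilinToMultilin (fun k => (Γ (![i, j] k)).H (a (![i, j] k))) e)
          (bilinToMultilin (fun k => (Γ (![i, j] k)).H (a (![i, j] k))) f) = 0) ∧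
      ∀ v : ∀ k, (Γ k).H (a k), (∀ k, k ≠ i → k ≠ j → v k = w k) → F v = f (v i) (v j)) :
    F ∈ (atom₂ i j hij R).interp.compl a := by
  refine QRel.cylinder_compl_le _ _ a ((QRel.mem_cylinder_iff _).2 fun w => ?_)
  obtain ⟨f, hf, h⟩ := h w
  refine ⟨bilinToMultilin (fun k => (Γ (![i, j] k)).H (a (![i, j] k))) f, ?_,
    fun v hv => h v fun k hi hj => hv k fun l => ?_⟩
  · rintro _ ⟨e, he, rfl⟩
    exact hf e he
  · fin_cases l
    · exact hi.symm
    · exact hj.symm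

end QFormula

/-! ### Bilinear functionals -/

theorem functionalInner_bilin {M : Fin 2 → Type v} [∀ i, NormedAddCommGroup (M i)]
    [∀ i, InnerProductSpace ℂ (M i)] [∀ i, FiniteDimensional ℂ (M i)] {κ : Fin 2 → Type*}
    [∀ i, Fintype (κ i)] (b : ∀ i, OrthonormalBasis (κ i) ℂ (M i))
    (f g : M 0 →ₗ[ℂ] M 1 →ₗ[ℂ] ℂ) :
    functionalInner (bilinToMultilin M f) (bilinToMultilin M g) =
      ∑ k, ∑ l, starRingEnd ℂ (f (b 0 k) (b 1 l)) * g (b 0 k) (b 1 l) := by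
  rw [functionalInner_eq b, ← (piFinTwoEquiv κ).symm.sum_comp, Fintype.sum_prod_type]
  rfl

/-- The basis of the dual space that is dual to an orthonormal basis. -/
def dualOrthonormalBasis (H : Type v) [NormedAddCommGroup H] [InnerProductSpace ℂ H]
    [FiniteDimensional ℂ H] [CompleteSpace H] {ι : Type*} [Fintype ι] (b : OrthonormalBasis ι ℂ H) :
    letI := dualInnerProductSpace H
    OrthonormalBasis ι ℂ (StrongDual ℂ H) :=
  letI := dualInnerProductSpace H
  OrthonormalBasis.mk (v := fun i => InnerProductSpace.toDual ℂ H (b i))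
    (by
      classical
      refine orthonormal_iff_ite.2 fun i j => ?_
      change ⟪(InnerProductSpace.toDual ℂ H).symm _, (InnerProductSpace.toDual ℂ H).symm _⟫_ℂ = _
      rw [LinearIsometryEquiv.symm_apply_apply, LinearIsometryEquiv.symm_apply_apply,
        orthonormal_iff_ite.1 b.orthonormal]
      simp [eq_comm])
    (fun ξ _ => by
      have : ξ = ∑ i, ξ (b i) • InnerProductSpace.toDual ℂ H (b i) := by
        ext x
        conv_lhs => rw [← b.sum_repr' x]
        simp [map_sum, mul_comm]
      rw [this]
      exact Submodule.sum_mem _ fun i _ => Submodule.smul_mem _ _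
        (Submodule.subset_span ⟨i, rfl⟩))

theorem dualOrthonormalBasis_apply (H : Type v) [NormedAddCommGroup H] [InnerProductSpace ℂ H]
    [FiniteDimensional ℂ H] [CompleteSpace H] {ι : Type*} [Fintype ι] (b : OrthonormalBasis ι ℂ H)
    (i : ι) (x : H) :
    letI := dualInnerProductSpace H
    dualOrthonormalBasis H b i x = ⟪b i, x⟫_ℂ := by
  simp [dualOrthonormalBasis]

end

/-! ### Products of functionals in separate variables -/

/-- The function `Φ` is linear in each of the variables in `s` and independent of the others. -/
structure IsMultilinearIn {n : ℕ} {M : Fin n → Type*} [∀ i, AddCommGroup (M i)]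
    [∀ i, Module ℂ (M i)] (s : Finset (Fin n)) (Φ : (∀ i, M i) → ℂ) : Prop where
  update_notMem : ∀ v, ∀ i ∉ s, ∀ x, Φ (Function.update v i x) = Φ v
  update_mem : ∀ v, ∀ i ∈ s, ∃ L : M i →ₗ[ℂ] ℂ, ∀ x, Φ (Function.update v i x) = L x

namespace IsMultilinearIn

variable {n : ℕ} {M : Fin n → Type*} [∀ i, AddCommGroup (M i)] [∀ i, Module ℂ (M i)]
  {s t : Finset (Fin n)} {Φ Ψ : (∀ i, M i) → ℂ}

/-- Each variable occurs in at most one factor, and the other factor is a constant in it. Bilinear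
functionals on a partition of the context into pairs thus multiply to a multilinear functional. -/
theorem mul (hst : Disjoint s t) (hΦ : IsMultilinearIn s Φ) (hΨ : IsMultilinearIn t Ψ) :
    IsMultilinearIn (s ∪ t) fun v => Φ v * Ψ v where
  update_notMem v i hi x := by
    rw [Finset.notMem_union] at hi
    rw [hΦ.update_notMem v i hi.1, hΨ.update_notMem v i hi.2]
  update_mem v i hi := by
    rcases Finset.mem_union.1 hi with h | h
    · obtain ⟨L, hL⟩ := hΦ.update_mem v i h
      refine ⟨Ψ v • L, fun x => ?_⟩
      rw [hL, hΨ.update_notMem v i (Finset.disjoint_left.1 hst h), LinearMap.smul_apply,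
        smul_eq_mul, mul_comm]
    · obtain ⟨L, hL⟩ := hΨ.update_mem v i h
      refine ⟨Φ v • L, fun x => ?_⟩
      rw [hL, hΦ.update_notMem v i (Finset.disjoint_right.1 hst h), LinearMap.smul_apply,
        smul_eq_mul]

theorem bilin {i j : Fin n} (hij : i ≠ j) (f : M i →ₗ[ℂ] M j →ₗ[ℂ] ℂ) :
    IsMultilinearIn {i, j} fun v => f (v i) (v j) where
  update_notMem v k hk x := by
    simp only [Finset.mem_insert, Finset.mem_singleton, not_or] at hk
    rw [Function.update_of_ne (Ne.symm hk.1), Function.update_of_ne (Ne.symm hk.2)]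
  update_mem v k hk := by
    simp only [Finset.mem_insert, Finset.mem_singleton] at hk
    rcases hk with rfl | rfl
    · exact ⟨f.flip (v j), fun x => by
        rw [Function.update_self, Function.update_of_ne hij.symm, LinearMap.flip_apply]⟩
    · exact ⟨f (v i), fun x => by rw [Function.update_self, Function.update_of_ne hij]⟩

theorem exists_eq (h : IsMultilinearIn Finset.univ Φ) :
    ∃ F : MultilinearMap ℂ M ℂ, ∀ v, F v = Φ v := by
  refine ⟨{ toFun := Φ, map_update_add' := ?_, map_update_smul' := ?_ }, fun v => rfl⟩
  · intro hd v i x y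
    obtain rfl : hd = instDecidableEqFin n := Subsingleton.elim _ _
    obtain ⟨L, hL⟩ := h.update_mem v i (Finset.mem_univ i)
    rw [hL, hL, hL, map_add]
  · intro hd v i c x
    obtain rfl : hd = instDecidableEqFin n := Subsingleton.elim _ _
    obtain ⟨L, hL⟩ := h.update_mem v i (Finset.mem_univ i)
    rw [hL, hL, map_smul]

end IsMultilinearIn

/-! ### Orthonormal frames of spaces of operators -/

/-- The inner product of bilinear functionals, in given orthonormal bases. -/
theorem functionalInner_bilin_bases {M : Fin 2 → Type v} [∀ i, NormedAddCommGroup (M i)]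
    [∀ i, InnerProductSpace ℂ (M i)] [∀ i, FiniteDimensional ℂ (M i)] {ι ι' : Type}
    [Fintype ι] [Fintype ι'] (b : OrthonormalBasis ι ℂ (M 0)) (c : OrthonormalBasis ι' ℂ (M 1))
    (f g : M 0 →ₗ[ℂ] M 1 →ₗ[ℂ] ℂ) :
    functionalInner (bilinToMultilin M f) (bilinToMultilin M g) =
      ∑ k, ∑ l, starRingEnd ℂ (f (b k) (c l)) * g (b k) (c l) := by
  let κ : Fin 2 → Type := Fin.cons ι fun _ => ι'
  let : ∀ i, Fintype (κ i) := Fin.cases ‹Fintype ι› fun _ => ‹Fintype ι'›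
  let B : ∀ i, OrthonormalBasis (κ i) ℂ (M i) :=
    Fin.cases b (Fin.cases c fun i => i.elim0)
  exact functionalInner_bilin B f g

/-- The orthocomplement of the atomic formula `R(xᵢ, xⱼ)` is tested in orthonormal bases by fixing
the other variables. -/
theorem QFormula.mem_compl_atom₂_of_bases {n : ℕ} {Γ : Fin n → QuantumSet.{u, v}} {i j : Fin n}
    (hij : i ≠ j) {R : BilinRel (Γ i) (Γ j)} {a : ∀ k, (Γ k).At} {ι ι' : Type} [Fintype ι]
    [Fintype ι'] (b : OrthonormalBasis ι ℂ ((Γ i).H (a i)))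
    (c : OrthonormalBasis ι' ℂ ((Γ j).H (a j)))
    {F : MultilinearMap ℂ (fun k => (Γ k).H (a k)) ℂ}
    (h : ∀ w : ∀ k, (Γ k).H (a k), ∃ f : (Γ i).H (a i) →ₗ[ℂ] (Γ j).H (a j) →ₗ[ℂ] ℂ,
      (∀ e ∈ R (a i) (a j),
        ∑ k, ∑ l, starRingEnd ℂ (e (b k) (c l)) * f (b k) (c l) = 0) ∧
      ∀ v : ∀ k, (Γ k).H (a k), (∀ k, k ≠ i → k ≠ j → v k = w k) → F v = f (v i) (v j)) :
    F ∈ (atom₂ i j hij R).interp.compl a :=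
  mem_compl_atom₂ hij fun w => by
    obtain ⟨f, hf, h⟩ := h w
    have key := functionalInner_bilin_bases
      (M := fun k => (Γ (![i, j] k)).H (a (![i, j] k))) b c
    exact ⟨f, fun e he => (key e f).trans (hf e he), h⟩

section

variable {H K : Type v} [NormedAddCommGroup H] [InnerProductSpace ℂ H]
  [NormedAddCommGroup K] [InnerProductSpace ℂ K]

/-- The difference of the functional `x ⊗ η ↦ ξ x * η y` and of its expansion
`∑ ξ (rₖ† y) η (rₖ x)` in a frame. -/
def frameResidual [CompleteSpace H] [CompleteSpace K] {d : ℕ} (r : Fin d → H →L[ℂ] K)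
    (ξ : StrongDual ℂ H) (y : K) :
    H →ₗ[ℂ] StrongDual ℂ K →ₗ[ℂ] ℂ :=
  ξ.toLinearMap.smulRight (ContinuousLinearMap.apply ℂ ℂ y).toLinearMap -
    ∑ k, ξ (ContinuousLinearMap.adjoint (r k) y) • bendOp H K (r k)

theorem frameResidual_apply [CompleteSpace H] [CompleteSpace K] {d : ℕ} (r : Fin d → H →L[ℂ] K)
    (ξ : StrongDual ℂ H) (y : K) (x : H) (η : StrongDual ℂ K) :
    frameResidual r ξ y x η =
      ξ x * η y - ∑ k, ξ (ContinuousLinearMap.adjoint (r k) y) * η (r k x) := by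
  simp [frameResidual, bendOp]

theorem bendOp_apply (r : H →L[ℂ] K) (x : H) (η : StrongDual ℂ K) : bendOp H K r x η = η (r x) :=
  rfl

theorem bendOp_injective [CompleteSpace K] : Function.Injective (bendOp H K) := by
  intro r s h
  ext x
  refine ext_inner_left ℂ fun y => ?_
  exact congrArg (fun f => f x (InnerProductSpace.toDual ℂ K y)) h

end

namespace QuantumSet

variable (X : QuantumSet.{u, v}) (a b : X.At)

/-- The arity `(X, X^*)`. -/
abbrev bendArity : Fin 2 → QuantumSet.{u, v} := ![X, X.dual]

/-- A pair of atoms. -/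
abbrev bendAtoms : ∀ k, (X.bendArity k).At :=
  Fin.cases (motive := fun k => (X.bendArity k).At) a
    (Fin.cases (motive := fun k => (X.bendArity k.succ).At) b fun i => i.elim0)

/-- The inner product of functionals on `X_a ⊗ X_b^*`. -/
def bilinInner (f g : X.H a →ₗ[ℂ] StrongDual ℂ (X.H b) →ₗ[ℂ] ℂ) : ℂ :=
  ∑ k, ∑ l, starRingEnd ℂ (f (stdOrthonormalBasis ℂ (X.H a) k)
    (dualOrthonormalBasis (X.H b) (stdOrthonormalBasis ℂ (X.H b)) l)) *
    g (stdOrthonormalBasis ℂ (X.H a) k)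
    (dualOrthonormalBasis (X.H b) (stdOrthonormalBasis ℂ (X.H b)) l)

/-- A functional on `X_a ⊗ X_b^*` as a multilinear functional. -/
def bilinFunctional : (X.H a →ₗ[ℂ] StrongDual ℂ (X.H b) →ₗ[ℂ] ℂ) →ₗ[ℂ]
    MultilinearMap ℂ (fun k => (X.bendArity k).H (X.bendAtoms a b k)) ℂ :=
  bilinToMultilin fun k => (X.bendArity k).H (X.bendAtoms a b k)

theorem functionalInner_bilinFunctional (f g : X.H a →ₗ[ℂ] StrongDual ℂ (X.H b) →ₗ[ℂ] ℂ) :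
    functionalInner (X.bilinFunctional a b f) (X.bilinFunctional a b g) = X.bilinInner a b f g :=
  functionalInner_bilin_bases (M := fun k => (X.bendArity k).H (X.bendAtoms a b k))
    (stdOrthonormalBasis ℂ (X.H a))
    (dualOrthonormalBasis (X.H b) (stdOrthonormalBasis ℂ (X.H b))) f g

theorem bilinFunctional_injective : Function.Injective (X.bilinFunctional a b) := by
  intro f g h
  ext x η
  exact congrArg (fun F => F (Fin.cons (α := fun k => (X.bendArity k).H (X.bendAtoms a b k)) x
    (Fin.cons (α := fun k : Fin 1 => (X.bendArity k.succ).H (X.bendAtoms a b k.succ)) η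
      fun i => i.elim0))) h

variable {a b}

/-- This is the coefficient of `ξ ⊗ y` along the bent operator `r`, found by Parseval in both bases;
it explains the coefficients in `frameResidual`. -/
theorem bilinInner_bendOp (r : X.H a →L[ℂ] X.H b) (ξ : StrongDual ℂ (X.H a)) (y : X.H b) :
    X.bilinInner a b (bendOp _ _ r)
      (ξ.toLinearMap.smulRight (ContinuousLinearMap.apply ℂ ℂ y).toLinearMap) =
      ξ (ContinuousLinearMap.adjoint r y) := by
  simp only [bilinInner, bendOp_apply, dualOrthonormalBasis_apply]
  have h1 : ∀ k, ∑ l, starRingEnd ℂ ⟪stdOrthonormalBasis ℂ (X.H b) l,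
      r (stdOrthonormalBasis ℂ (X.H a) k)⟫_ℂ *
        (ξ (stdOrthonormalBasis ℂ (X.H a) k) * ⟪stdOrthonormalBasis ℂ (X.H b) l, y⟫_ℂ) =
      ⟪stdOrthonormalBasis ℂ (X.H a) k, ContinuousLinearMap.adjoint r y⟫_ℂ *
        ξ (stdOrthonormalBasis ℂ (X.H a) k) := by
    intro k
    rw [ContinuousLinearMap.adjoint_inner_right, ← (stdOrthonormalBasis ℂ (X.H b)).sum_inner_mul_inner,
      Finset.sum_mul]
    refine Finset.sum_congr rfl fun l _ => ?_
    rw [inner_conj_symm]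
    ring
  conv_rhs => rw [← (stdOrthonormalBasis ℂ (X.H a)).sum_repr' (ContinuousLinearMap.adjoint r y),
    map_sum]
  refine Finset.sum_congr rfl fun k _ => ?_
  rw [map_smul, smul_eq_mul, ← h1]
  refine Finset.sum_congr rfl fun l _ => ?_
  simp [dualOrthonormalBasis_apply]

/-- A space of operators has a frame that is orthonormal in the Hilbert-Schmidt inner product. -/
theorem exists_operator_frame (R : Submodule ℂ (X.H a →L[ℂ] X.H b)) :
    ∃ (d : ℕ) (r : Fin d → X.H a →L[ℂ] X.H b), (∀ k, r k ∈ R) ∧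
      (∀ s ∈ R, s ∈ Submodule.span ℂ (Set.range r)) ∧
      (∀ ξ y, ∀ s ∈ R, X.bilinInner a b (bendOp _ _ s) (frameResidual r ξ y) = 0) ∧
      ∀ (U : Type v) [AddCommGroup U] [Module ℂ U] (W : Submodule ℂ U) (w : Fin d → U),
        (∀ (x : X.H a) (η : StrongDual ℂ (X.H b)), ∑ k, η (r k x) • w k ∈ W) → ∀ k, w k ∈ W := by
  obtain ⟨d, e, he, hee, hres, hspan⟩ :=
    exists_functional_frame ((R.map (bendOp _ _)).map (X.bilinFunctional a b))
  have he' : ∀ k, ∃ s ∈ R, X.bilinFunctional a b (bendOp _ _ s) = e k := by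
    intro k
    obtain ⟨_, ⟨s, hs, rfl⟩, h⟩ := he k
    exact ⟨s, hs, h⟩
  choose r hr hre using he'
  refine ⟨d, r, hr, fun s hs => ?_, fun ξ y s hs => ?_, fun U _ _ W w h l => ?_⟩
  · have h := hspan _ ⟨_, ⟨s, hs, rfl⟩, rfl⟩
    simp only [← hre, ← map_smul, ← map_sum] at h
    rw [bendOp_injective (X.bilinFunctional_injective a b h)]
    exact Submodule.sum_mem _ fun k _ => Submodule.smul_mem _ _ (Submodule.subset_span ⟨k, rfl⟩)
  · have h := hres (X.bilinFunctional a b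
      (ξ.toLinearMap.smulRight (ContinuousLinearMap.apply ℂ ℂ y).toLinearMap)) _
      ⟨_, ⟨s, hs, rfl⟩, rfl⟩
    simp only [← hre, functionalInner_bilinFunctional, bilinInner_bendOp,
      ← map_smul (X.bilinFunctional a b), ← map_sum (X.bilinFunctional a b), ← map_sub] at h
    exact h
  · have h1 : ∀ m, X.bilinInner a b (bendOp _ _ (r l)) (bendOp _ _ (r m)) =
        if l = m then 1 else 0 := fun m => by
      rw [← functionalInner_bilinFunctional, hre, hre, hee]
    -- Orthonormality isolates `w l`. Written out in bases, the inner products make this a linear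
    -- combination of the sums `∑ k, η (r k x) • w k` for basis vectors `x` and `η`, which lie in
    -- `W`.
    have h2 : w l = ∑ m, X.bilinInner a b (bendOp _ _ (r l)) (bendOp _ _ (r m)) • w m := by
      simp [h1]
    rw [h2]
    simp only [bilinInner, Finset.sum_smul, mul_smul]
    rw [Finset.sum_comm]
    refine Submodule.sum_mem _ fun k _ => ?_
    rw [Finset.sum_comm]
    refine Submodule.sum_mem _ fun j _ => ?_
    rw [← Finset.smul_sum]
    exact Submodule.smul_mem _ _ (h _ _)

end QuantumSet

/-! ### The diagonal quantifier -/

theorem equalityRel_self (X : QuantumSet.{u, v}) (i : X.At) :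
    equalityRel X i i = Submodule.span ℂ {bendOp (X.H i) (X.H i) 1} := by
  refine congrArg (Submodule.span ℂ) (Set.ext fun f => ?_)
  constructor
  · rintro ⟨_, h⟩
    exact LinearMap.ext fun x => LinearMap.ext fun ξ => h x ξ
  · rintro rfl
    exact ⟨rfl, fun x ξ => rfl⟩

theorem equalityRel_of_ne (X : QuantumSet.{u, v}) {i j : X.At} (h : i ≠ j) :
    equalityRel X i j = ⊥ := by
  refine Submodule.span_eq_bot.2 ?_
  rintro f ⟨h', _⟩
  exact absurd h' h

section

variable {n : ℕ} {Γ : Fin n → QuantumSet.{u, v}}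

/-- The functional `ε ⊗ f`, where `ε` is the evaluation functional. -/
def diagMul {X : QuantumSet.{u, v}} (i : X.At) {a : ∀ k, (Γ k).At}
    (f : MultilinearMap ℂ (fun k => (Γ k).H (a k)) ℂ) :
    ConsFunctional (X := X) i (consAtoms (X := X.dual) i a) :=
  ∑ k, consMul (X := X) (innerSL ℂ (stdOrthonormalBasis ℂ (X.H i) k)).toLinearMap
    (consMul (X := X.dual)
      (ContinuousLinearMap.apply ℂ ℂ (stdOrthonormalBasis ℂ (X.H i) k)).toLinearMap f)

theorem diagMul_apply {X : QuantumSet.{u, v}} (i : X.At) {a : ∀ k, (Γ k).At}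
    (f : MultilinearMap ℂ (fun k => (Γ k).H (a k)) ℂ)
    (v : ∀ k, (Matrix.vecCons X (Matrix.vecCons X.dual Γ) k).H
      (consAtoms (X := X) i (consAtoms (X := X.dual) i a) k)) :
    diagMul i f v = bendOp (X.H i) (X.H i) 1 (v 0) (v 1) * f fun k => v k.succ.succ := by
  have h : ∀ (x : X.H i) (ξ : StrongDual ℂ (X.H i)) (c : ℂ), bendOp (X.H i) (X.H i) 1 x ξ * c =
      ∑ k, ⟪stdOrthonormalBasis ℂ (X.H i) k, x⟫_ℂ *
        (ξ (stdOrthonormalBasis ℂ (X.H i) k) * c) := by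
    intro x ξ c
    change ξ x * c = _
    conv_lhs => rw [← (stdOrthonormalBasis ℂ (X.H i)).sum_repr' x, map_sum, Finset.sum_mul]
    simp [mul_assoc]
  refine Eq.trans ?_ (h (v 0) (v 1) _).symm
  rw [diagMul, sum_apply]
  refine Finset.sum_congr rfl fun k _ => ?_
  rw [consMul_apply]
  exact congrArg (_ * ·) (consMul_apply (X := X.dual) _ f fun k => v k.succ)

namespace QFormula

/-- The diagonal quantifier tests a formula on the evaluation functionals. -/
theorem mem_allDiag_iff {X : QuantumSet.{u, v}}
    {φ : QFormula (Matrix.vecCons X (Matrix.vecCons X.dual Γ))} {a : ∀ k, (Γ k).At}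
    {f : MultilinearMap ℂ (fun k => (Γ k).H (a k)) ℂ} :
    f ∈ (allDiag X φ).interp a ↔
      ∀ i : X.At, diagMul i f ∈ φ.interp (consAtoms (X := X) i (consAtoms (X := X.dual) i a)) := by
  have hε : ∀ i : X.At, diagMul i f ∈ (atom₂ (Γ := Matrix.vecCons X (Matrix.vecCons X.dual Γ)) 0 1
      (by simp) (equalityRel X)).interp (consAtoms (X := X) i (consAtoms (X := X.dual) i a)) := by
    intro i
    refine (mem_atom₂_iff _).2 fun w => ?_
    let F : X.H i →ₗ[ℂ] StrongDual ℂ (X.H i) →ₗ[ℂ] ℂ :=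
      (f fun k => w k.succ.succ) • bendOp (X.H i) (X.H i) 1
    refine ⟨F, ?_, fun v hv => ?_⟩
    · refine Submodule.smul_mem _ _ ?_
      change bendOp (X.H i) (X.H i) 1 ∈ equalityRel X i i
      rw [equalityRel_self]
      exact Submodule.mem_span_singleton_self _
    · rw [diagMul_apply, mul_comm]
      have : f (fun k => v k.succ.succ) = f fun k => w k.succ.succ :=
        congrArg f (funext fun k => hv k.succ.succ (Fin.succ_ne_zero _) (Fin.succ_succ_ne_one k))
      rw [this]
      rfl
  unfold allDiag
  rw [mem_all_iff]
  simp only [mem_all_iff (φ := imp _ _)]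
  constructor
  · intro h i
    refine (mem_imp_iff (hε i) ?_).1 (?_ : diagMul i f ∈ _)
    · rw [sub_self]
      exact Submodule.zero_mem _
    -- `diagMul` is by definition a sum of the product functionals that the two universal
    -- quantifiers test.
    · unfold diagMul
      exact Submodule.sum_mem _ fun k _ => h i _ i _
  · intro h j g i g'
    by_cases hij : i = j
    · subst hij
      let b := stdOrthonormalBasis ℂ (X.H i)
      -- The coefficient `⟪ε, g' ⊗ g⟫ / ⟪ε, ε⟫` of the projection of `g' ⊗ g` onto the line of `ε`,
      -- where `⟪ε, ε⟫` is the dimension of the atom.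
      let c : ℂ := (∑ k, g' (b k) * g (dualOrthonormalBasis (X.H i) b k)) /
        Module.finrank ℂ (X.H i)
      refine (mem_imp_iff (Submodule.smul_mem _ c (hε i)) ?_).2 (Submodule.smul_mem _ c (h i))
      refine mem_compl_atom₂ _ fun w => ?_
      let F : X.H i →ₗ[ℂ] StrongDual ℂ (X.H i) →ₗ[ℂ] ℂ := (f fun k => w k.succ.succ) •
        (LinearMap.smulRight g' g - c • bendOp (X.H i) (X.H i) 1)
      refine ⟨F, fun e he => ?_, fun v hv => ?_⟩
      · refine (functionalInner_bilin_bases b (dualOrthonormalBasis (X.H i) b) _ _).trans ?_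
        obtain ⟨c', hc'⟩ := Submodule.mem_span_singleton.1 ((equalityRel_self X i).le he)
        have h1 : ∀ k l, e (b k) (dualOrthonormalBasis (X.H i) b l) = if k = l then c' else 0 := by
          intro k l
          rw [← hc']
          change c' * dualOrthonormalBasis (X.H i) b l (b k) = _
          rw [dualOrthonormalBasis_apply, orthonormal_iff_ite.1 b.orthonormal]
          simp [eq_comm]
        have h2 : ∀ k, F (b k) (dualOrthonormalBasis (X.H i) b k) = (f fun k => w k.succ.succ) *
            (g' (b k) * g (dualOrthonormalBasis (X.H i) b k) - c) := by
          intro k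
          change _ * (_ * _ - c * dualOrthonormalBasis (X.H i) b k (b k)) = _
          rw [dualOrthonormalBasis_apply, orthonormal_iff_ite.1 b.orthonormal]
          simp
        have h3 : (Module.finrank ℂ (X.H i) : ℂ) ≠ 0 :=
          Nat.cast_ne_zero.2 Module.finrank_pos.ne'
        calc _ = ∑ k, starRingEnd ℂ c' * F (b k) (dualOrthonormalBasis (X.H i) b k) := by
              refine Finset.sum_congr rfl fun k _ => ?_
              rw [Finset.sum_eq_single k]
              · exact congrArg (starRingEnd ℂ · * _) ((h1 k k).trans (if_pos rfl))
              · intro l _ hl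
                refine mul_eq_zero_of_left ?_ _
                exact (congrArg (starRingEnd ℂ) ((h1 k l).trans (if_neg hl.symm))).trans (map_zero _)
              · simp
          _ = 0 := by
              simp_rw [h2]
              rw [← Finset.mul_sum, ← Finset.mul_sum, Finset.sum_sub_distrib]
              simp [c, mul_div_cancel₀ _ h3]
      · have : f (fun k => v k.succ.succ) = f fun k => w k.succ.succ :=
          congrArg f (funext fun k => hv k.succ.succ (Fin.succ_ne_zero _) (Fin.succ_succ_ne_one k))
        have h1 : F (v 0) (v 1) = (f fun k => w k.succ.succ) *
          (g' (v 0) * g (v 1) - c * bendOp (X.H i) (X.H i) 1 (v 0) (v 1)) := rfl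
        have h2 : consMul (X := X) g' (consMul (X := X.dual) g f) v =
            g' (v 0) * (g (v 1) * f fun k => v k.succ.succ) :=
          (consMul_apply g' _ v).trans
            (congrArg (_ * ·) (consMul_apply (X := X.dual) g f fun k => v k.succ))
        refine Eq.trans ?_ h1.symm
        rw [sub_apply, smul_apply, diagMul_apply, h2, ← this, smul_eq_mul]
        ring
    -- On distinct atoms the equality relation is zero, so the projection onto the antecedent is
    -- `0`.
    · refine (mem_imp_iff (Submodule.zero_mem _) ?_).2 (Submodule.zero_mem _)
      intro e he
      have : e = 0 := by
        ext v
        obtain ⟨f', hf', hv⟩ := (mem_atom₂_iff _).1 he v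
        refine (hv v fun _ _ _ => rfl).trans ?_
        have := (Submodule.mem_bot ℂ).1 ((equalityRel_of_ne X hij).le hf')
        exact congrArg (fun F : X.H i →ₗ[ℂ] StrongDual ℂ (X.H j) →ₗ[ℂ] ℂ => F (v 0) (v 1)) this
      rw [this]
      simp [functionalInner]

/-- In the empty context the space of functionals is a line, so a subspace is `⊤` once it contains
`1`. -/
theorem allDiag_holds_iff {X : QuantumSet.{u, v}}
    {φ : QFormula (Matrix.vecCons X (Matrix.vecCons X.dual ![]))} :
    (allDiag X φ).Holds ↔
      MultilinearMap.constOfIsEmpty ℂ _ 1 ∈ (allDiag X φ).interp (fun k => k.elim0) := by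
  constructor
  · intro h
    rw [h]
    trivial
  · intro h
    refine eq_top_iff.2 fun a f _ => ?_
    obtain rfl : a = fun k => k.elim0 := Subsingleton.elim _ _
    have : f = f (fun k => k.elim0) • MultilinearMap.constOfIsEmpty ℂ _ 1 := by
      ext v
      obtain rfl : v = fun k => k.elim0 := Subsingleton.elim _ _
      simp
    rw [this]
    exact Submodule.smul_mem _ _ h

end QFormula

end

/-! ### The three sentences -/

section

variable {n : ℕ} {Γ : Fin n → QuantumSet.{u, v}}

/-- A choice of vectors for a context with two additional first variables `x` and `x_*`. -/
def diagVec {X : QuantumSet.{u, v}} {i : X.At} {a : ∀ k, (Γ k).At} (x : X.H i)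
    (ξ : StrongDual ℂ (X.H i)) (v : ∀ k, (Γ k).H (a k)) :
    ∀ k, (Matrix.vecCons X (Matrix.vecCons X.dual Γ) k).H
      (consAtoms (X := X) i (consAtoms (X := X.dual) i a) k) :=
  Fin.cons (α := fun k => (Matrix.vecCons X (Matrix.vecCons X.dual Γ) k).H
    (consAtoms (X := X) i (consAtoms (X := X.dual) i a) k)) x
    (Fin.cons (α := fun k => (Matrix.vecCons X.dual Γ k).H (consAtoms (X := X.dual) i a k)) ξ v)

theorem exists_eq_diagVec {X : QuantumSet.{u, v}} {i : X.At} {a : ∀ k, (Γ k).At}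
    (w : ∀ k, (Matrix.vecCons X (Matrix.vecCons X.dual Γ) k).H
      (consAtoms (X := X) i (consAtoms (X := X.dual) i a) k)) :
    ∃ x ξ v, w = diagVec x ξ v := by
  refine ⟨w 0, w 1, fun k => w k.succ.succ, funext fun k => ?_⟩
  refine Fin.cases rfl (fun k => ?_) k
  exact Fin.cases rfl (fun k => rfl) k

theorem diagMul_diagVec {X : QuantumSet.{u, v}} {i : X.At} {a : ∀ k, (Γ k).At}
    (f : MultilinearMap ℂ (fun k => (Γ k).H (a k)) ℂ) (x : X.H i)
    (ξ : StrongDual ℂ (X.H i)) (v : ∀ k, (Γ k).H (a k)) :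
    diagMul i f (diagVec x ξ v) = ξ x * f v :=
  diagMul_apply i f _

end

namespace BinRel

variable {X : QuantumSet.{u, v}}

theorem bendOp_mem_bend_iff {R : BinRel X X} {a b : X.At} {r : X.H a →L[ℂ] X.H b} :
    bendOp _ _ r ∈ R.bend a b ↔ r ∈ R a b :=
  ⟨fun ⟨_, hs, h⟩ => bendOp_injective h ▸ hs, fun h => ⟨r, h, rfl⟩⟩

/-- The diagonal quantifier tests `R̆` on `ε`, which is the bent identity operator. -/
theorem reflSentence_holds_iff (R : BinRel X X) :
    R.reflSentence.Holds ↔ ∀ i, (1 : X.H i →L[ℂ] X.H i) ∈ R i i := by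
  refine QFormula.allDiag_holds_iff.trans (QFormula.mem_allDiag_iff.trans (forall_congr' fun i => ?_))
  refine (QFormula.mem_atom₂_iff _).trans ?_
  constructor
  · intro h
    obtain ⟨f, hf, h⟩ := h 0
    have : f = bendOp (X.H i) (X.H i) 1 := by
      refine LinearMap.ext fun x => LinearMap.ext fun ξ => ?_
      refine ((h (diagVec x ξ fun k => k.elim0) fun k h0 h1 => ?_).symm.trans
        (diagMul_diagVec _ x ξ _)).trans (mul_one _)
      fin_cases k
      · exact absurd rfl h0
      · exact absurd rfl h1
    subst this
    exact bendOp_mem_bend_iff.1 hf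
  · intro h w
    refine ⟨bendOp (X.H i) (X.H i) 1, bendOp_mem_bend_iff.2 h, fun v _ => ?_⟩
    obtain ⟨x, ξ, v, rfl⟩ := exists_eq_diagVec v
    exact (diagMul_diagVec _ x ξ _).trans (mul_one _)

/-- Two nested diagonal quantifiers: the variables `x₂, x₂_*, x₁, x₁_*`. -/
abbrev arity₄ (X : QuantumSet.{u, v}) : Fin 4 → QuantumSet.{u, v} :=
  Matrix.vecCons X (Matrix.vecCons X.dual (Matrix.vecCons X (Matrix.vecCons X.dual ![])))

/-- The atoms `b, b^*, a, a^*`. -/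
abbrev atoms₄ (a b : X.At) : ∀ k, (arity₄ X k).At :=
  consAtoms (X := X) b (consAtoms (X := X.dual) b (consAtoms (X := X) a
    (consAtoms (X := X.dual) a fun k => k.elim0)))

/-- The vectors `x₂, ξ₂, x₁, ξ₁`. -/
abbrev vec₄ {a b : X.At} (x₂ : X.H b) (ξ₂ : StrongDual ℂ (X.H b)) (x₁ : X.H a)
    (ξ₁ : StrongDual ℂ (X.H a)) : ∀ k, (arity₄ X k).H (atoms₄ a b k) :=
  diagVec x₂ ξ₂ (diagVec x₁ ξ₁ fun k => k.elim0)

theorem exists_eq_vec₄ {a b : X.At} (w : ∀ k, (arity₄ X k).H (atoms₄ a b k)) :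
    ∃ x₂ ξ₂ x₁ ξ₁, w = vec₄ x₂ ξ₂ x₁ ξ₁ := by
  obtain ⟨x₂, ξ₂, w, rfl⟩ := exists_eq_diagVec w
  obtain ⟨x₁, ξ₁, w, rfl⟩ := exists_eq_diagVec w
  obtain rfl : w = fun k => k.elim0 := Subsingleton.elim _ _
  exact ⟨x₂, ξ₂, x₁, ξ₁, rfl⟩

/-- Variables `2` and `1` are `x₁` and `x₂_*`, so this is the formula `R̆(x₁, x₂_*)`, and its slices
fix `x₂` and `ξ₁`. -/
theorem mem_atom₂_21_iff {a b : X.At} {R : BilinRel X X.dual}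
    {F : MultilinearMap ℂ (fun k => (arity₄ X k).H (atoms₄ a b k)) ℂ} :
    F ∈ (QFormula.atom₂ (Γ := arity₄ X) 2 1 (by decide) R).interp (atoms₄ a b) ↔
      ∀ x₂ ξ₁, ∃ f ∈ R a b, ∀ x₁ ξ₂, F (vec₄ x₂ ξ₂ x₁ ξ₁) = f x₁ ξ₂ := by
  refine (QFormula.mem_atom₂_iff _).trans ⟨fun h y₂ η₁ => ?_, fun h w => ?_⟩
  · obtain ⟨f, hf, h⟩ := h (vec₄ y₂ 0 0 η₁)
    refine ⟨f, hf, fun x₁ ξ₂ => h _ fun k h2 h1 => ?_⟩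
    fin_cases k
    · rfl
    · exact absurd rfl h1
    · exact absurd rfl h2
    · rfl
  · obtain ⟨y₂, η₂, y₁, η₁, rfl⟩ := exists_eq_vec₄ w
    obtain ⟨f, hf, h⟩ := h y₂ η₁
    refine ⟨f, hf, fun v hv => ?_⟩
    obtain ⟨x₂, ξ₂, x₁, ξ₁, rfl⟩ := exists_eq_vec₄ v
    obtain rfl : x₂ = y₂ := hv 0 (by decide) (by decide)
    obtain rfl : ξ₁ = η₁ := hv 3 (by decide) (by decide)
    exact h x₁ ξ₂

theorem mem_atom₂_03_iff {a b : X.At} {R : BilinRel X X.dual}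
    {F : MultilinearMap ℂ (fun k => (arity₄ X k).H (atoms₄ a b k)) ℂ} :
    F ∈ (QFormula.atom₂ (Γ := arity₄ X) 0 3 (by decide) R).interp (atoms₄ a b) ↔
      ∀ x₁ ξ₂, ∃ f ∈ R b a, ∀ x₂ ξ₁, F (vec₄ x₂ ξ₂ x₁ ξ₁) = f x₂ ξ₁ := by
  refine (QFormula.mem_atom₂_iff _).trans ⟨fun h y₁ η₂ => ?_, fun h w => ?_⟩
  · obtain ⟨f, hf, h⟩ := h (vec₄ 0 η₂ y₁ 0)
    refine ⟨f, hf, fun x₁ ξ₂ => h _ fun k h2 h1 => ?_⟩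
    fin_cases k
    · exact absurd rfl h2
    · rfl
    · rfl
    · exact absurd rfl h1
  · obtain ⟨y₂, η₂, y₁, η₁, rfl⟩ := exists_eq_vec₄ w
    obtain ⟨f, hf, h⟩ := h y₁ η₂
    refine ⟨f, hf, fun v hv => ?_⟩
    obtain ⟨x₂, ξ₂, x₁, ξ₁, rfl⟩ := exists_eq_vec₄ v
    obtain rfl : ξ₂ = η₂ := hv 1 (by decide) (by decide)
    obtain rfl : x₁ = y₁ := hv 2 (by decide) (by decide)
    exact h x₂ ξ₁

theorem mem_compl_atom₂_21 {a b : X.At} {R : BilinRel X X.dual}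
    {F : MultilinearMap ℂ (fun k => (arity₄ X k).H (atoms₄ a b k)) ℂ}
    (h : ∀ x₂ ξ₁, ∃ f, (∀ e ∈ R a b, X.bilinInner a b e f = 0) ∧
      ∀ x₁ ξ₂, F (vec₄ x₂ ξ₂ x₁ ξ₁) = f x₁ ξ₂) :
    F ∈ (QFormula.atom₂ (Γ := arity₄ X) 2 1 (by decide) R).interp.compl (atoms₄ a b) := by
  refine QFormula.mem_compl_atom₂_of_bases (Γ := arity₄ X) _ (stdOrthonormalBasis ℂ (X.H a))
    (dualOrthonormalBasis (X.H b) (stdOrthonormalBasis ℂ (X.H b))) fun w => ?_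
  obtain ⟨y₂, η₂, y₁, η₁, rfl⟩ := exists_eq_vec₄ w
  obtain ⟨f, hf, h⟩ := h y₂ η₁
  refine ⟨f, hf, fun v hv => ?_⟩
  obtain ⟨x₂, ξ₂, x₁, ξ₁, rfl⟩ := exists_eq_vec₄ v
  obtain rfl : x₂ = y₂ := hv 0 (by decide) (by decide)
  obtain rfl : ξ₁ = η₁ := hv 3 (by decide) (by decide)
  exact h x₁ ξ₂

theorem exists_functional₄ {a b : X.At} (f : X.H a →ₗ[ℂ] StrongDual ℂ (X.H b) →ₗ[ℂ] ℂ)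
    (g : X.H b →ₗ[ℂ] StrongDual ℂ (X.H a) →ₗ[ℂ] ℂ) :
    ∃ p : MultilinearMap ℂ (fun k => (arity₄ X k).H (atoms₄ a b k)) ℂ,
      ∀ x₂ ξ₂ x₁ ξ₁, p (vec₄ x₂ ξ₂ x₁ ξ₁) = f x₁ ξ₂ * g x₂ ξ₁ := by
  let M := fun k => (arity₄ X k).H (atoms₄ a b k)
  have h1 := IsMultilinearIn.bilin (M := M) (i := 2) (j := 1) (by decide) f
  have h2 := IsMultilinearIn.bilin (M := M) (i := 0) (j := 3) (by decide) g
  have h := h1.mul (by decide) h2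
  rw [show ({2, 1} ∪ {0, 3} : Finset (Fin 4)) = Finset.univ by decide] at h
  obtain ⟨p, hp⟩ := h.exists_eq
  exact ⟨p, fun _ _ _ _ => hp _⟩

theorem adjoint_mem_iff_of_frame {a b : X.At} {S : Submodule ℂ (X.H a →L[ℂ] X.H b)} {d : ℕ}
    {r : Fin d → X.H a →L[ℂ] X.H b} (hr : ∀ k, r k ∈ S)
    (hspan : ∀ s ∈ S, s ∈ Submodule.span ℂ (Set.range r))
    (T : Submodule ℂ (X.H b →L[ℂ] X.H a)) :
    (∀ k, ContinuousLinearMap.adjoint (r k) ∈ T) ↔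
      ∀ s ∈ S, ContinuousLinearMap.adjoint s ∈ T := by
  have key : ∀ s ∈ Submodule.span ℂ (Set.range r), (∀ k, ContinuousLinearMap.adjoint (r k) ∈ T) →
      ContinuousLinearMap.adjoint s ∈ T := by
    intro s hs h
    induction hs using Submodule.span_induction with
    | mem s hs =>
      obtain ⟨k, rfl⟩ := hs
      exact h k
    | zero =>
      rw [map_zero]
      exact Submodule.zero_mem _
    | add s t _ _ hs ht =>
      rw [map_add]
      exact Submodule.add_mem _ hs ht
    | smul c s _ hs =>
      rw [map_smulₛₗ]
      exact Submodule.smul_mem _ _ hs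
  exact ⟨fun h s hs => key s (hspan s hs) h, fun h k => h _ (hr k)⟩

/-- The functional under test is `ξ₂(x₂) ξ₁(x₁)`. For fixed `x₂` and `ξ₁` it is the product `ξ₁ ⊗
x₂` in `x₁` and `ξ₂`, with coefficient `ξ₁(rₖ† x₂)` along the frame element `rₖ` of `R a b`. Its
projection `∑ ξ₂(rₖ x₁) ξ₁(rₖ† x₂)`, read as a functional of `x₂` and `ξ₁`, is a combination of the
bent operators `rₖ†`. -/
theorem symmSentence_holds_iff (R : BinRel X X) :
    R.symmSentence.Holds ↔
      ∀ a b, ∀ r ∈ R a b, ContinuousLinearMap.adjoint r ∈ R b a := by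
  refine QFormula.allDiag_holds_iff.trans (QFormula.mem_allDiag_iff.trans (forall_congr' fun a =>
    QFormula.mem_allDiag_iff.trans (forall_congr' fun b => ?_)))
  obtain ⟨d, r, hr, hspan, hres, hrec⟩ := X.exists_operator_frame (R a b)
  rw [← adjoint_mem_iff_of_frame hr hspan]
  choose q hq using fun k => exists_functional₄ (bendOp (X.H a) (X.H b) (r k))
    (bendOp (X.H b) (X.H a) (ContinuousLinearMap.adjoint (r k)))
  have hp : ∀ x₂ ξ₂ x₁ ξ₁, (∑ k, q k) (vec₄ x₂ ξ₂ x₁ ξ₁) =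
      ∑ k, ξ₂ (r k x₁) * ξ₁ (ContinuousLinearMap.adjoint (r k) x₂) := by
    intro x₂ ξ₂ x₁ ξ₁
    rw [sum_apply]
    exact Finset.sum_congr rfl fun k _ => hq k x₂ ξ₂ x₁ ξ₁
  refine (QFormula.mem_imp_iff (p := ∑ k, q k) (mem_atom₂_21_iff.2 fun x₂ ξ₁ => ?_)
    (mem_compl_atom₂_21 fun x₂ ξ₁ => ?_)).trans (mem_atom₂_03_iff.trans ?_)
  · refine ⟨∑ k, ξ₁ (ContinuousLinearMap.adjoint (r k) x₂) • bendOp _ _ (r k),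
      Submodule.sum_mem _ fun k _ => Submodule.smul_mem _ _ (bendOp_mem_bend_iff.2 (hr k)),
      fun x₁ ξ₂ => ?_⟩
    rw [hp]
    simp [bendOp_apply, mul_comm]
  -- The slices of the difference are frame residuals, hence orthogonal to the bent operators of `R
  -- a b`.
  · refine ⟨frameResidual r ξ₁ x₂, ?_, fun x₁ ξ₂ => ?_⟩
    · rintro _ ⟨s, hs, rfl⟩
      exact hres ξ₁ x₂ s hs
    · rw [sub_apply, hp, diagMul_diagVec, diagMul_diagVec, frameResidual_apply]
      simp [mul_comm]
  · simp_rw [← bendOp_mem_bend_iff]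
    constructor
    · intro h
      -- The slices only give the sums `∑ ξ₂(rₖ x₁) • bendOp (rₖ†)`; the recovery property of the
      -- frame extracts the individual terms as `x₁` and `ξ₂` vary.
      refine hrec _ (R.bend b a) (fun k => bendOp _ _ (ContinuousLinearMap.adjoint (r k)))
        fun x₁ ξ₂ => ?_
      obtain ⟨f, hf, hfv⟩ := h x₁ ξ₂
      convert hf
      refine LinearMap.ext fun x₂ => LinearMap.ext fun ξ₁ => ?_
      rw [← hfv, hp]
      simp [bendOp_apply]
    · intro h x₁ ξ₂
      refine ⟨∑ k, ξ₂ (r k x₁) • bendOp _ _ (ContinuousLinearMap.adjoint (r k)),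
        Submodule.sum_mem _ fun k _ => Submodule.smul_mem _ _ (h k), fun x₂ ξ₁ => ?_⟩
      rw [hp]
      simp [bendOp_apply]

end BinRel

/-! ### Conjunctions and the transitivity sentence -/

theorem QFormula.mem_and {n : ℕ} {Γ : Fin n → QuantumSet.{u, v}} {φ ψ : QFormula Γ}
    {a : ∀ i, (Γ i).At} {p : MultilinearMap ℂ (fun i => (Γ i).H (a i)) ℂ}
    (h : p ∈ φ.interp a) (h' : p ∈ ψ.interp a) : p ∈ (QFormula.and φ ψ).interp a := ⟨h, h'⟩

/-- This certifies a projection onto a meet in two stages: the error of projecting onto `φ` plus the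
error of projecting the result onto `ψ` is orthogonal to `φ ∧ ψ`. -/
theorem QFormula.add_mem_compl_and {n : ℕ} {Γ : Fin n → QuantumSet.{u, v}} {φ ψ : QFormula Γ}
    {a : ∀ i, (Γ i).At} {p q : MultilinearMap ℂ (fun i => (Γ i).H (a i)) ℂ}
    (h : p ∈ φ.interp.compl a) (h' : q ∈ ψ.interp.compl a) :
    p + q ∈ (QFormula.and φ ψ).interp.compl a :=
  Submodule.add_mem _ (fun e he => h e he.1) fun e he => h' e he.2

namespace QuantumSet

variable (X : QuantumSet.{u, v}) {a b : X.At}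

theorem bilinInner_smul_right (e f : X.H a →ₗ[ℂ] StrongDual ℂ (X.H b) →ₗ[ℂ] ℂ) (c : ℂ) :
    X.bilinInner a b e (c • f) = c * X.bilinInner a b e f := by
  simp only [bilinInner, Finset.mul_sum, LinearMap.smul_apply, smul_eq_mul, mul_left_comm]

theorem bilinInner_sum_right {ι : Type*} [Fintype ι]
    (e : X.H a →ₗ[ℂ] StrongDual ℂ (X.H b) →ₗ[ℂ] ℂ)
    (f : ι → X.H a →ₗ[ℂ] StrongDual ℂ (X.H b) →ₗ[ℂ] ℂ) :
    X.bilinInner a b e (∑ m, f m) = ∑ m, X.bilinInner a b e (f m) := by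
  simp only [bilinInner, Finset.mul_sum, LinearMap.sum_apply]
  exact (Finset.sum_congr rfl fun k _ => Finset.sum_comm).trans Finset.sum_comm

end QuantumSet

namespace BinRel

variable {X : QuantumSet.{u, v}}

/-- Three nested diagonal quantifiers: the variables `x₃, x₃_*, x₂, x₂_*, x₁, x₁_*`. -/
abbrev arity₆ (X : QuantumSet.{u, v}) : Fin 6 → QuantumSet.{u, v} :=
  Matrix.vecCons X (Matrix.vecCons X.dual (arity₄ X))

/-- The atoms `c, c^*, b, b^*, a, a^*`. -/
abbrev atoms₆ (a b c : X.At) : ∀ k, (arity₆ X k).At :=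
  consAtoms (X := X) c (consAtoms (X := X.dual) c (atoms₄ a b))

/-- The vectors `x₃, ξ₃, x₂, ξ₂, x₁, ξ₁`. -/
abbrev vec₆ {a b c : X.At} (x₃ : X.H c) (ξ₃ : StrongDual ℂ (X.H c)) (x₂ : X.H b)
    (ξ₂ : StrongDual ℂ (X.H b)) (x₁ : X.H a) (ξ₁ : StrongDual ℂ (X.H a)) :
    ∀ k, (arity₆ X k).H (atoms₆ a b c k) :=
  diagVec x₃ ξ₃ (vec₄ x₂ ξ₂ x₁ ξ₁)

theorem exists_eq_vec₆ {a b c : X.At} (w : ∀ k, (arity₆ X k).H (atoms₆ a b c k)) :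
    ∃ x₃ ξ₃ x₂ ξ₂ x₁ ξ₁, w = vec₆ x₃ ξ₃ x₂ ξ₂ x₁ ξ₁ := by
  obtain ⟨x₃, ξ₃, w, rfl⟩ := exists_eq_diagVec w
  obtain ⟨x₂, ξ₂, x₁, ξ₁, rfl⟩ := exists_eq_vec₄ w
  exact ⟨x₃, ξ₃, x₂, ξ₂, x₁, ξ₁, rfl⟩

theorem mem_atom₂_43 {a b c : X.At} {R : BilinRel X X.dual}
    {F : MultilinearMap ℂ (fun k => (arity₆ X k).H (atoms₆ a b c k)) ℂ}
    (h : ∀ x₃ ξ₃ x₂ ξ₁, ∃ f ∈ R a b, ∀ x₁ ξ₂, F (vec₆ x₃ ξ₃ x₂ ξ₂ x₁ ξ₁) = f x₁ ξ₂) :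
    F ∈ (QFormula.atom₂ (Γ := arity₆ X) 4 3 (by decide) R).interp (atoms₆ a b c) := by
  refine (QFormula.mem_atom₂_iff _).2 fun w => ?_
  obtain ⟨y₃, η₃, y₂, η₂, y₁, η₁, rfl⟩ := exists_eq_vec₆ w
  obtain ⟨f, hf, h⟩ := h y₃ η₃ y₂ η₁
  refine ⟨f, hf, fun v hv => ?_⟩
  obtain ⟨x₃, ξ₃, x₂, ξ₂, x₁, ξ₁, rfl⟩ := exists_eq_vec₆ v
  obtain rfl : x₃ = y₃ := hv 0 (by decide) (by decide)
  obtain rfl : ξ₃ = η₃ := hv 1 (by decide) (by decide)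
  obtain rfl : x₂ = y₂ := hv 2 (by decide) (by decide)
  obtain rfl : ξ₁ = η₁ := hv 5 (by decide) (by decide)
  exact h x₁ ξ₂

theorem mem_atom₂_21 {a b c : X.At} {R : BilinRel X X.dual}
    {F : MultilinearMap ℂ (fun k => (arity₆ X k).H (atoms₆ a b c k)) ℂ}
    (h : ∀ x₃ ξ₂ x₁ ξ₁, ∃ f ∈ R b c, ∀ x₂ ξ₃, F (vec₆ x₃ ξ₃ x₂ ξ₂ x₁ ξ₁) = f x₂ ξ₃) :
    F ∈ (QFormula.atom₂ (Γ := arity₆ X) 2 1 (by decide) R).interp (atoms₆ a b c) := by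
  refine (QFormula.mem_atom₂_iff _).2 fun w => ?_
  obtain ⟨y₃, η₃, y₂, η₂, y₁, η₁, rfl⟩ := exists_eq_vec₆ w
  obtain ⟨f, hf, h⟩ := h y₃ η₂ y₁ η₁
  refine ⟨f, hf, fun v hv => ?_⟩
  obtain ⟨x₃, ξ₃, x₂, ξ₂, x₁, ξ₁, rfl⟩ := exists_eq_vec₆ v
  obtain rfl : x₃ = y₃ := hv 0 (by decide) (by decide)
  obtain rfl : ξ₂ = η₂ := hv 3 (by decide) (by decide)
  obtain rfl : x₁ = y₁ := hv 4 (by decide) (by decide)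
  obtain rfl : ξ₁ = η₁ := hv 5 (by decide) (by decide)
  exact h x₂ ξ₃

theorem mem_atom₂_50_iff {a b c : X.At} {R : BilinRel X.dual X}
    {F : MultilinearMap ℂ (fun k => (arity₆ X k).H (atoms₆ a b c k)) ℂ} :
    F ∈ (QFormula.atom₂ (Γ := arity₆ X) 5 0 (by decide) R).interp (atoms₆ a b c) ↔
      ∀ ξ₃ x₂ ξ₂ x₁, ∃ f ∈ R a c, ∀ ξ₁ x₃, F (vec₆ x₃ ξ₃ x₂ ξ₂ x₁ ξ₁) = f ξ₁ x₃ := by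
  refine (QFormula.mem_atom₂_iff _).trans ⟨fun h η₃ y₂ η₂ y₁ => ?_, fun h w => ?_⟩
  · obtain ⟨f, hf, h⟩ := h (vec₆ 0 η₃ y₂ η₂ y₁ 0)
    refine ⟨f, hf, fun ξ₁ x₃ => h _ fun k h5 h0 => ?_⟩
    fin_cases k
    · exact absurd rfl h0
    · exact (rfl : η₃ = η₃)
    · exact (rfl : y₂ = y₂)
    · exact (rfl : η₂ = η₂)
    · exact (rfl : y₁ = y₁)
    · exact absurd rfl h5
  · obtain ⟨y₃, η₃, y₂, η₂, y₁, η₁, rfl⟩ := exists_eq_vec₆ w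
    obtain ⟨f, hf, h⟩ := h η₃ y₂ η₂ y₁
    refine ⟨f, hf, fun v hv => ?_⟩
    obtain ⟨x₃, ξ₃, x₂, ξ₂, x₁, ξ₁, rfl⟩ := exists_eq_vec₆ v
    obtain rfl : ξ₃ = η₃ := hv 1 (by decide) (by decide)
    obtain rfl : x₂ = y₂ := hv 2 (by decide) (by decide)
    obtain rfl : ξ₂ = η₂ := hv 3 (by decide) (by decide)
    obtain rfl : x₁ = y₁ := hv 4 (by decide) (by decide)
    exact h ξ₁ x₃

theorem mem_compl_atom₂_43 {a b c : X.At} {R : BilinRel X X.dual}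
    {F : MultilinearMap ℂ (fun k => (arity₆ X k).H (atoms₆ a b c k)) ℂ}
    (h : ∀ x₃ ξ₃ x₂ ξ₁, ∃ f, (∀ e ∈ R a b, X.bilinInner a b e f = 0) ∧
      ∀ x₁ ξ₂, F (vec₆ x₃ ξ₃ x₂ ξ₂ x₁ ξ₁) = f x₁ ξ₂) :
    F ∈ (QFormula.atom₂ (Γ := arity₆ X) 4 3 (by decide) R).interp.compl (atoms₆ a b c) := by
  refine QFormula.mem_compl_atom₂_of_bases (Γ := arity₆ X) _ (stdOrthonormalBasis ℂ (X.H a))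
    (dualOrthonormalBasis (X.H b) (stdOrthonormalBasis ℂ (X.H b))) fun w => ?_
  obtain ⟨y₃, η₃, y₂, η₂, y₁, η₁, rfl⟩ := exists_eq_vec₆ w
  obtain ⟨f, hf, h⟩ := h y₃ η₃ y₂ η₁
  refine ⟨f, hf, fun v hv => ?_⟩
  obtain ⟨x₃, ξ₃, x₂, ξ₂, x₁, ξ₁, rfl⟩ := exists_eq_vec₆ v
  obtain rfl : x₃ = y₃ := hv 0 (by decide) (by decide)
  obtain rfl : ξ₃ = η₃ := hv 1 (by decide) (by decide)
  obtain rfl : x₂ = y₂ := hv 2 (by decide) (by decide)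
  obtain rfl : ξ₁ = η₁ := hv 5 (by decide) (by decide)
  exact h x₁ ξ₂

theorem mem_compl_atom₂_21_of_six {a b c : X.At} {R : BilinRel X X.dual}
    {F : MultilinearMap ℂ (fun k => (arity₆ X k).H (atoms₆ a b c k)) ℂ}
    (h : ∀ x₃ ξ₂ x₁ ξ₁, ∃ f, (∀ e ∈ R b c, X.bilinInner b c e f = 0) ∧
      ∀ x₂ ξ₃, F (vec₆ x₃ ξ₃ x₂ ξ₂ x₁ ξ₁) = f x₂ ξ₃) :
    F ∈ (QFormula.atom₂ (Γ := arity₆ X) 2 1 (by decide) R).interp.compl (atoms₆ a b c) := by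
  refine QFormula.mem_compl_atom₂_of_bases (Γ := arity₆ X) _ (stdOrthonormalBasis ℂ (X.H b))
    (dualOrthonormalBasis (X.H c) (stdOrthonormalBasis ℂ (X.H c))) fun w => ?_
  obtain ⟨y₃, η₃, y₂, η₂, y₁, η₁, rfl⟩ := exists_eq_vec₆ w
  obtain ⟨f, hf, h⟩ := h y₃ η₂ y₁ η₁
  refine ⟨f, hf, fun v hv => ?_⟩
  obtain ⟨x₃, ξ₃, x₂, ξ₂, x₁, ξ₁, rfl⟩ := exists_eq_vec₆ v
  obtain rfl : x₃ = y₃ := hv 0 (by decide) (by decide)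
  obtain rfl : ξ₂ = η₂ := hv 3 (by decide) (by decide)
  obtain rfl : x₁ = y₁ := hv 4 (by decide) (by decide)
  obtain rfl : ξ₁ = η₁ := hv 5 (by decide) (by decide)
  exact h x₂ ξ₃

/-- The pairing of variables in the projection onto the whole antecedent of transitivity. -/
theorem exists_functional₆ {a b c : X.At} (f : X.H a →ₗ[ℂ] StrongDual ℂ (X.H b) →ₗ[ℂ] ℂ)
    (g : X.H b →ₗ[ℂ] StrongDual ℂ (X.H c) →ₗ[ℂ] ℂ)
    (h : StrongDual ℂ (X.H a) →ₗ[ℂ] X.H c →ₗ[ℂ] ℂ) :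
    ∃ p : MultilinearMap ℂ (fun k => (arity₆ X k).H (atoms₆ a b c k)) ℂ,
      ∀ x₃ ξ₃ x₂ ξ₂ x₁ ξ₁, p (vec₆ x₃ ξ₃ x₂ ξ₂ x₁ ξ₁) = f x₁ ξ₂ * g x₂ ξ₃ * h ξ₁ x₃ := by
  let M := fun k => (arity₆ X k).H (atoms₆ a b c k)
  have h1 := IsMultilinearIn.bilin (M := M) (i := 4) (j := 3) (by decide) f
  have h2 := IsMultilinearIn.bilin (M := M) (i := 2) (j := 1) (by decide) g
  have h3 := IsMultilinearIn.bilin (M := M) (i := 5) (j := 0) (by decide) h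
  have h := (h1.mul (by decide) h2).mul (by decide) h3
  rw [show ({4, 3} ∪ {2, 1} ∪ {5, 0} : Finset (Fin 6)) = Finset.univ by decide] at h
  obtain ⟨p, hp⟩ := h.exists_eq
  exact ⟨p, fun _ _ _ _ _ _ => hp _⟩

/-- The pairing of variables at the intermediate stage, after projection onto the first conjunct
only. -/
theorem exists_functional₆' {a b c : X.At} (f : X.H a →ₗ[ℂ] StrongDual ℂ (X.H b) →ₗ[ℂ] ℂ)
    (g : X.H b →ₗ[ℂ] StrongDual ℂ (X.H a) →ₗ[ℂ] ℂ)
    (h : X.H c →ₗ[ℂ] StrongDual ℂ (X.H c) →ₗ[ℂ] ℂ) :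
    ∃ p : MultilinearMap ℂ (fun k => (arity₆ X k).H (atoms₆ a b c k)) ℂ,
      ∀ x₃ ξ₃ x₂ ξ₂ x₁ ξ₁, p (vec₆ x₃ ξ₃ x₂ ξ₂ x₁ ξ₁) = f x₁ ξ₂ * g x₂ ξ₁ * h x₃ ξ₃ := by
  let M := fun k => (arity₆ X k).H (atoms₆ a b c k)
  have h1 := IsMultilinearIn.bilin (M := M) (i := 4) (j := 3) (by decide) f
  have h2 := IsMultilinearIn.bilin (M := M) (i := 2) (j := 5) (by decide) g
  have h3 := IsMultilinearIn.bilin (M := M) (i := 0) (j := 1) (by decide) h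
  have h := (h1.mul (by decide) h2).mul (by decide) h3
  rw [show ({4, 3} ∪ {2, 5} ∪ {0, 1} : Finset (Fin 6)) = Finset.univ by decide] at h
  obtain ⟨p, hp⟩ := h.exists_eq
  exact ⟨p, fun _ _ _ _ _ _ => hp _⟩

/-- The functional `ξ ⊗ y ↦ ξ (s† y)`. -/
def conjFunctional {a c : X.At} (s : X.H a →L[ℂ] X.H c) :
    StrongDual ℂ (X.H a) →ₗ[ℂ] X.H c →ₗ[ℂ] ℂ :=
  bendDualOp _ _ (conjOp s)

theorem conjFunctional_apply {a c : X.At} (s : X.H a →L[ℂ] X.H c) (ξ : StrongDual ℂ (X.H a))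
    (y : X.H c) : conjFunctional s ξ y = ξ (ContinuousLinearMap.adjoint s y) := rfl

/-- Because `conjOp` is conjugate linear, it maps `R a c` onto a subspace, and the span in
`BinRel.conjugate` adds nothing; the operator is then recovered because taking adjoints is
injective. -/
theorem conjFunctional_mem_iff {R : BinRel X X} {a c : X.At} {s : X.H a →L[ℂ] X.H c} :
    conjFunctional s ∈ R.conjugate.bendDual a c ↔ s ∈ R a c := by
  constructor
  · rintro ⟨t, ht, hts⟩
    have h1 : ∃ s' ∈ R a c, t = conjOp s' := by
      clear hts
      induction ht using Submodule.span_induction with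
      | mem t ht =>
        obtain ⟨s', hs', rfl⟩ := ht
        exact ⟨s', hs', rfl⟩
      | zero =>
        refine ⟨0, Submodule.zero_mem _, ?_⟩
        ext ξ y
        simp [conjOp]
      | add t t' _ _ ht ht' =>
        obtain ⟨s, hs, rfl⟩ := ht
        obtain ⟨s', hs', rfl⟩ := ht'
        refine ⟨s + s', Submodule.add_mem _ hs hs', ?_⟩
        ext ξ y
        simp [conjOp]
      | smul k t _ ht =>
        obtain ⟨s, hs, rfl⟩ := ht
        refine ⟨starRingEnd ℂ k • s, Submodule.smul_mem _ _ hs, ?_⟩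
        ext ξ y
        simp [conjOp, map_smulₛₗ]
    obtain ⟨s', hs', rfl⟩ := h1
    have h2 : s = s' := by
      rw [← ContinuousLinearMap.adjoint.injective.eq_iff]
      ext y
      refine ext_inner_left ℂ fun x => ?_
      exact (congrArg (fun F : StrongDual ℂ (X.H a) →ₗ[ℂ] X.H c →ₗ[ℂ] ℂ =>
        F (InnerProductSpace.toDual ℂ _ x) y) hts).symm
    rw [h2]
    exact hs'
  · intro h
    exact ⟨_, Submodule.subset_span ⟨s, h, rfl⟩, rfl⟩

theorem comp_mem_iff_of_frames {a b c : X.At} {S : Submodule ℂ (X.H a →L[ℂ] X.H b)}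
    {S' : Submodule ℂ (X.H b →L[ℂ] X.H c)} {d d' : ℕ} {r : Fin d → X.H a →L[ℂ] X.H b}
    {s : Fin d' → X.H b →L[ℂ] X.H c} (hr : ∀ k, r k ∈ S) (hs : ∀ k, s k ∈ S')
    (hspan : ∀ t ∈ S, t ∈ Submodule.span ℂ (Set.range r))
    (hspan' : ∀ t ∈ S', t ∈ Submodule.span ℂ (Set.range s))
    (T : Submodule ℂ (X.H a →L[ℂ] X.H c)) :
    (∀ k l, s l ∘L r k ∈ T) ↔ ∀ t ∈ S, ∀ t' ∈ S', t' ∘L t ∈ T := by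
  refine ⟨fun h t ht t' ht' => ?_, fun h k l => h _ (hr k) _ (hs l)⟩
  have h1 : ∀ l, s l ∘L t ∈ T := by
    intro l
    have := Submodule.span_le (p := T.comap (ContinuousLinearMap.postcomp (X.H a) (s l)).toLinearMap)
      (s := Set.range r)
    exact this.2 (by rintro _ ⟨k, rfl⟩; exact h k l) (hspan t ht)
  have := Submodule.span_le (p := T.comap (ContinuousLinearMap.precomp (X.H c) t).toLinearMap)
    (s := Set.range s)
  exact this.2 (by rintro _ ⟨l, rfl⟩; exact h1 l) (hspan' t' ht')


/-- Projecting `ξ₃(x₃) ξ₂(x₂) ξ₁(x₁)` onto `R̆(x₁, x₂_*)` gives `∑ q k`, and projecting that onto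
`R̆(x₂, x₃_*)` gives `∑ p k l`. The result still lies in the first conjunct, so it is the projection
onto the meet. Its dependence on `ξ₁` and `x₃` is through `ξ₁((sₗ rₖ)† x₃)`, the functional of `sₗ
rₖ` in the conjugate relation. -/
theorem transSentence_holds_iff (R : BinRel X X) :
    R.transSentence.Holds ↔ ∀ a b c, ∀ r ∈ R a b, ∀ s ∈ R b c, s ∘L r ∈ R a c := by
  refine QFormula.allDiag_holds_iff.trans (QFormula.mem_allDiag_iff.trans (forall_congr' fun a =>
    QFormula.mem_allDiag_iff.trans (forall_congr' fun b => QFormula.mem_allDiag_iff.trans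
    (forall_congr' fun c => ?_))))
  obtain ⟨d, r, hr, hspan, hres, hrec⟩ := X.exists_operator_frame (R a b)
  obtain ⟨d', s, hs, hspan', hres', hrec'⟩ := X.exists_operator_frame (R b c)
  rw [← comp_mem_iff_of_frames hr hs hspan hspan']
  choose q hq using fun k => exists_functional₆' (c := c) (bendOp (X.H a) (X.H b) (r k))
    (bendOp (X.H b) (X.H a) (ContinuousLinearMap.adjoint (r k))) (bendOp (X.H c) (X.H c) 1)
  have hq' : ∀ x₃ ξ₃ x₂ ξ₂ x₁ ξ₁, (∑ k, q k) (vec₆ x₃ ξ₃ x₂ ξ₂ x₁ ξ₁) =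
      ∑ k, ξ₂ (r k x₁) * ξ₁ (ContinuousLinearMap.adjoint (r k) x₂) * ξ₃ x₃ := by
    intro x₃ ξ₃ x₂ ξ₂ x₁ ξ₁
    rw [sum_apply]
    exact Finset.sum_congr rfl fun k _ => hq k x₃ ξ₃ x₂ ξ₂ x₁ ξ₁
  choose p hp using fun k l => exists_functional₆ (bendOp (X.H a) (X.H b) (r k))
    (bendOp (X.H b) (X.H c) (s l)) (conjFunctional (s l ∘L r k))
  have hp' : ∀ x₃ ξ₃ x₂ ξ₂ x₁ ξ₁, (∑ k, ∑ l, p k l) (vec₆ x₃ ξ₃ x₂ ξ₂ x₁ ξ₁) =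
      ∑ k, ∑ l, ξ₂ (r k x₁) * ξ₃ (s l x₂) *
        ξ₁ (ContinuousLinearMap.adjoint (r k) (ContinuousLinearMap.adjoint (s l) x₃)) := by
    intro x₃ ξ₃ x₂ ξ₂ x₁ ξ₁
    rw [sum_apply]
    refine Finset.sum_congr rfl fun k _ => ?_
    rw [sum_apply]
    refine Finset.sum_congr rfl fun l _ => (hp k l x₃ ξ₃ x₂ ξ₂ x₁ ξ₁).trans ?_
    rw [conjFunctional_apply, ContinuousLinearMap.adjoint_comp]
    rfl
  -- The second projection changes only the coefficients of the bent `rₖ`, which do not involve `x₁`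
  -- and `ξ₂`; so it does not leave the first conjunct.
  have hA₁ : ∑ k, ∑ l, p k l ∈ (QFormula.atom₂ (Γ := arity₆ X) 4 3 (by decide) R.bend).interp
      (atoms₆ a b c) := by
    refine mem_atom₂_43 fun x₃ ξ₃ x₂ ξ₁ => ⟨∑ k, (∑ l, ξ₃ (s l x₂) *
      ξ₁ (ContinuousLinearMap.adjoint (r k) (ContinuousLinearMap.adjoint (s l) x₃))) •
      bendOp _ _ (r k), Submodule.sum_mem _ fun k _ =>
        Submodule.smul_mem _ _ (bendOp_mem_bend_iff.2 (hr k)), fun x₁ ξ₂ => ?_⟩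
    rw [hp']
    simp only [LinearMap.sum_apply, LinearMap.smul_apply, bendOp_apply, smul_eq_mul, Finset.sum_mul]
    exact Finset.sum_congr rfl fun k _ => Finset.sum_congr rfl fun l _ => by ring
  have hA₂ : ∑ k, ∑ l, p k l ∈ (QFormula.atom₂ (Γ := arity₆ X) 2 1 (by decide) R.bend).interp
      (atoms₆ a b c) := by
    refine mem_atom₂_21 fun x₃ ξ₂ x₁ ξ₁ => ⟨∑ l, (∑ k, ξ₂ (r k x₁) *
      ξ₁ (ContinuousLinearMap.adjoint (r k) (ContinuousLinearMap.adjoint (s l) x₃))) •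
      bendOp _ _ (s l), Submodule.sum_mem _ fun l _ =>
        Submodule.smul_mem _ _ (bendOp_mem_bend_iff.2 (hs l)), fun x₂ ξ₃ => ?_⟩
    rw [hp', Finset.sum_comm]
    simp only [LinearMap.sum_apply, LinearMap.smul_apply, bendOp_apply, smul_eq_mul, Finset.sum_mul]
    exact Finset.sum_congr rfl fun k _ => Finset.sum_congr rfl fun l _ => by ring
  have hC₁ : diagMul c (diagMul b (diagMul a (MultilinearMap.constOfIsEmpty ℂ _ 1))) - ∑ k, q k ∈
      (QFormula.atom₂ (Γ := arity₆ X) 4 3 (by decide) R.bend).interp.compl (atoms₆ a b c) := by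
    refine mem_compl_atom₂_43 fun x₃ ξ₃ x₂ ξ₁ => ⟨ξ₃ x₃ • frameResidual r ξ₁ x₂, ?_, ?_⟩
    · rintro _ ⟨t, ht, rfl⟩
      rw [QuantumSet.bilinInner_smul_right, hres ξ₁ x₂ t ht, mul_zero]
    · intro x₁ ξ₂
      rw [sub_apply, hq', diagMul_diagVec, diagMul_diagVec, diagMul_diagVec, LinearMap.smul_apply,
        LinearMap.smul_apply, frameResidual_apply, ← Finset.sum_mul]
      simp only [MultilinearMap.constOfIsEmpty_apply, Function.const_apply, smul_eq_mul, mul_comm (ξ₂ _)]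
      ring
  -- In `x₂` and `ξ₃`, the `k`-th term of `∑ q k` is a multiple of the product `(ξ₁ ∘ rₖ†) ⊗ x₃`,
  -- whose coefficient along `sₗ` is `ξ₁(rₖ† (sₗ† x₃))`.
  have hC₂ : ∑ k, q k - ∑ k, ∑ l, p k l ∈
      (QFormula.atom₂ (Γ := arity₆ X) 2 1 (by decide) R.bend).interp.compl (atoms₆ a b c) := by
    refine mem_compl_atom₂_21_of_six fun x₃ ξ₂ x₁ ξ₁ => ⟨∑ k, ξ₂ (r k x₁) •
      frameResidual s (ξ₁ ∘L ContinuousLinearMap.adjoint (r k)) x₃, ?_, ?_⟩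
    · rintro _ ⟨t, ht, rfl⟩
      rw [QuantumSet.bilinInner_sum_right]
      refine Finset.sum_eq_zero fun k _ => ?_
      rw [QuantumSet.bilinInner_smul_right, hres' _ x₃ t ht, mul_zero]
    · intro x₂ ξ₃
      rw [sub_apply, hq', hp', ← Finset.sum_sub_distrib]
      simp only [LinearMap.sum_apply, LinearMap.smul_apply, frameResidual_apply, smul_eq_mul]
      refine Finset.sum_congr rfl fun k _ => ?_
      rw [mul_sub, Finset.mul_sum]
      congr 1
      · simp [mul_assoc]
      · refine Finset.sum_congr rfl fun l _ => ?_
        simp only [ContinuousLinearMap.comp_apply]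
        ring
  have hC := QFormula.add_mem_compl_and hC₁ hC₂
  rw [sub_add_sub_cancel] at hC
  refine (QFormula.mem_imp_iff (QFormula.mem_and hA₁ hA₂) hC).trans (mem_atom₂_50_iff.trans ?_)
  · simp_rw [← conjFunctional_mem_iff]
    constructor
    · intro h
      -- The double sum is separated one index at a time: the frame of `R a b` isolates `k`, granted
      -- membership of the sums over `k`, and these are isolated in `l` by the frame of `R b c`.
      refine fun k l => hrec _ (R.conjugate.bendDual a c) (fun k => conjFunctional (s l ∘L r k))
        (fun x₁ ξ₂ => ?_) k
      refine hrec' _ (R.conjugate.bendDual a c)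
        (fun l => ∑ k, ξ₂ (r k x₁) • conjFunctional (s l ∘L r k)) (fun x₂ ξ₃ => ?_) l
      obtain ⟨f, hf, hfv⟩ := h ξ₃ x₂ ξ₂ x₁
      convert hf
      refine LinearMap.ext fun ξ₁ => LinearMap.ext fun x₃ => ?_
      rw [← hfv, hp', Finset.sum_comm]
      simp only [LinearMap.sum_apply, LinearMap.smul_apply, conjFunctional_apply, smul_eq_mul,
        Finset.mul_sum, ContinuousLinearMap.adjoint_comp, ContinuousLinearMap.comp_apply]
      exact Finset.sum_congr rfl fun k _ => Finset.sum_congr rfl fun l _ => by ring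
    · intro h ξ₃ x₂ ξ₂ x₁
      refine ⟨∑ k, ∑ l, (ξ₂ (r k x₁) * ξ₃ (s l x₂)) • conjFunctional (s l ∘L r k),
        Submodule.sum_mem _ fun k _ => Submodule.sum_mem _ fun l _ =>
          Submodule.smul_mem _ _ (h k l), fun ξ₁ x₃ => ?_⟩
      rw [hp']
      simp only [LinearMap.sum_apply, LinearMap.smul_apply, conjFunctional_apply, smul_eq_mul,
        ContinuousLinearMap.adjoint_comp, ContinuousLinearMap.comp_apply]

end BinRel

/-! ### The ultraweak topology -/

section

variable {H : Type u} [NormedAddCommGroup H] [InnerProductSpace ℂ H]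

/-- This is the defining functional for two sequences supported at the index `0`. -/
theorem continuous_ultraweak_inner (x y : H) :
    Continuous[ultraweakTopology H, inferInstance] fun T : H →L[ℂ] H => ⟪x, T y⟫_ℂ := by
  have h : (fun T : H →L[ℂ] H => ⟪x, T y⟫_ℂ) = fun T => ∑' n,
      ⟪lp.single (E := fun _ : ℕ => H) 2 0 x n, T (lp.single (E := fun _ : ℕ => H) 2 0 y n)⟫_ℂ := by
    funext T
    rw [tsum_eq_single 0]
    · simp
    · intro n hn
      simp [hn]
  rw [h]
  exact continuous_iInf_dom (i := lp.single 2 0 x)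
    (continuous_iInf_dom (i := lp.single 2 0 y) continuous_induced_dom)

theorem tendsto_ultraweak_iff {α : Type*} {l : Filter α} {f : α → H →L[ℂ] H} {T : H →L[ℂ] H} :
    Filter.Tendsto f l (@nhds _ (ultraweakTopology H) T) ↔
      ∀ x y : lp (fun _ : ℕ => H) 2, Filter.Tendsto (fun a => ∑' n, ⟪x n, f a (y n)⟫_ℂ) l
        (𝓝 (∑' n, ⟪x n, T (y n)⟫_ℂ)) := by
  simp only [nhds_iInf, Filter.tendsto_iInf, nhds_induced, Filter.tendsto_comap_iff]
  rfl

theorem summable_norm_mul_norm {E : Type*} [NormedAddCommGroup E] (x y : lp (fun _ : ℕ => E) 2) :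
    Summable fun n => ‖x n‖ * ‖y n‖ := by
  have h : ∀ z : lp (fun _ : ℕ => E) 2, Summable fun n => ‖z n‖ ^ 2 := fun z => by
    simpa using (lp.hasSum_norm (by simp) z).summable
  refine Summable.of_nonneg_of_le (fun n => by positivity) (fun n => ?_) ((h x).add (h y))
  nlinarith [sq_nonneg (‖x n‖ - ‖y n‖), sq_nonneg (‖x n‖), sq_nonneg (‖y n‖)]

/-- Commutation with `S` amounts to the equations `⟪S† x, T y⟫ = ⟪x, T (S y)⟫`, whose two sides are
ultraweakly continuous in `T`. -/
theorem VonNeumannAlgebra.isClosed_commutant [CompleteSpace H] (M : VonNeumannAlgebra H) :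
    IsClosed[ultraweakTopology H] (M.commutant : Set (H →L[ℂ] H)) := by
  have h : (M.commutant : Set (H →L[ℂ] H)) = ⋂ S ∈ M, ⋂ x : H, ⋂ y : H,
      {T | ⟪ContinuousLinearMap.adjoint S x, T y⟫_ℂ = ⟪x, T (S y)⟫_ℂ} := by
    ext T
    simp only [SetLike.mem_coe, VonNeumannAlgebra.mem_commutant_iff, Set.mem_iInter,
      Set.mem_ofPred_eq]
    refine forall₂_congr fun S _ => ?_
    rw [ContinuousLinearMap.ext_iff]
    simp only [ContinuousLinearMap.adjoint_inner_left]
    rw [forall_comm]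
    refine forall_congr' fun y => ⟨fun h x => ?_, fun h => ext_inner_left ℂ h⟩
    exact congrArg (inner ℂ x) h
  rw [h]
  let := ultraweakTopology H
  refine isClosed_biInter fun S _ => isClosed_iInter fun x => isClosed_iInter fun y => ?_
  exact @isClosed_eq _ _ _ (ultraweakTopology H) _ _ _ (continuous_ultraweak_inner _ _)
    (continuous_ultraweak_inner _ _)

end

/-! ### Operators on the sum of the atoms -/

namespace QuantumSet

variable (X : QuantumSet.{u, v})

/-- The block `inc_b† T inc_a`. -/
def block (T : X.Hilb →L[ℂ] X.Hilb) (a b : X.At) : X.H a →L[ℂ] X.H b :=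
  ContinuousLinearMap.adjoint (X.inc b) ∘L T ∘L X.inc a

theorem block_apply (T : X.Hilb →L[ℂ] X.Hilb) (a b : X.At) (x : X.H a) :
    X.block T a b x = T (X.inc a x) b :=
  X.adjoint_inc_apply b _

/-- The operator `inc_b r inc_a†`. -/
def unblock {a b : X.At} (r : X.H a →L[ℂ] X.H b) : X.Hilb →L[ℂ] X.Hilb :=
  X.inc b ∘L r ∘L ContinuousLinearMap.adjoint (X.inc a)

theorem unblock_apply {a b : X.At} (r : X.H a →L[ℂ] X.H b) (f : X.Hilb) :
    X.unblock r f = X.inc b (r (f a)) :=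
  congrArg (fun x => X.inc b (r x)) (X.adjoint_inc_apply a f)

/-- The projection onto an atom. -/
def atomProj (a : X.At) : X.Hilb →L[ℂ] X.Hilb :=
  X.inc a ∘L ContinuousLinearMap.adjoint (X.inc a)

theorem atomProj_apply (a : X.At) (f : X.Hilb) : X.atomProj a f = X.inc a (f a) :=
  congrArg (X.inc a) (X.adjoint_inc_apply a f)

theorem mem_compress_iff {V : Submodule ℂ (X.Hilb →L[ℂ] X.Hilb)} {a b : X.At}
    {r : X.H a →L[ℂ] X.H b} : r ∈ X.compress V a b ↔ ∃ T ∈ V, X.block T a b = r :=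
  Iff.rfl

/-- The space of the operators whose blocks belong to a given binary relation. -/
def ofBinRel (R : BinRel X X) : Submodule ℂ (X.Hilb →L[ℂ] X.Hilb) where
  carrier := {T | ∀ a b, X.block T a b ∈ R a b}
  zero_mem' a b := by
    have : X.block 0 a b = 0 := by ext x; simp [block]
    rw [this]
    exact Submodule.zero_mem _
  add_mem' {S T} hS hT a b := by
    have : X.block (S + T) a b = X.block S a b + X.block T a b := by ext x; simp [block]
    rw [this]
    exact Submodule.add_mem _ (hS a b) (hT a b)
  smul_mem' c T hT a b := by
    have : X.block (c • T) a b = c • X.block T a b := by ext x; simp [block]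
    rw [this]
    exact Submodule.smul_mem _ _ (hT a b)

theorem unblock_mem_ofBinRel {R : BinRel X X} {a b : X.At} {r : X.H a →L[ℂ] X.H b}
    (hr : r ∈ R a b) : X.unblock r ∈ X.ofBinRel R := by
  intro c d
  by_cases hc : c = a
  · subst hc
    by_cases hd : d = b
    · subst hd
      convert hr
      ext x
      rw [block_apply, unblock_apply, inc_apply_self, inc_apply_self]
    · convert Submodule.zero_mem _
      ext x
      rw [block_apply, unblock_apply, inc_apply_ne X hd]
      rfl
  · convert Submodule.zero_mem _
    ext x
    rw [block_apply, unblock_apply, inc_apply_ne X (Ne.symm hc), map_zero, map_zero]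
    rfl

/-- Every `r` in `R a b` is realized by an operator that has it as its only possibly nonzero block.
-/
theorem compress_ofBinRel (R : BinRel X X) : X.compress (X.ofBinRel R) = R := by
  funext a b
  ext r
  rw [mem_compress_iff]
  constructor
  · rintro ⟨T, hT, rfl⟩
    exact hT a b
  · intro hr
    refine ⟨_, X.unblock_mem_ofBinRel hr, ?_⟩
    ext x
    rw [block_apply, unblock_apply, inc_apply_self, inc_apply_self]

/-- The projection onto finitely many atoms. -/
def finProj (F : Finset X.At) : X.Hilb →L[ℂ] X.Hilb := ∑ a ∈ F, X.atomProj a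

theorem finProj_apply (F : Finset X.At) (f : X.Hilb) : X.finProj F f = ∑ a ∈ F, X.inc a (f a) := by
  simp [finProj, atomProj_apply]

theorem tendsto_finProj (f : X.Hilb) :
    Filter.Tendsto (fun F => X.finProj F f) Filter.atTop (𝓝 f) := by
  classical
  simp only [finProj_apply]
  have h := lp.hasSum_single (p := 2) (by simp) f
  refine h.congr fun F => Finset.sum_congr rfl fun a _ => ?_
  simp only [inc, lp.singleContinuousLinearMap_apply]

theorem norm_finProj_le (F : Finset X.At) (f : X.Hilb) : ‖X.finProj F f‖ ≤ ‖f‖ := by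
  classical
  have h1 : X.finProj F f = ∑ a ∈ F, lp.single 2 a (f a) := by
    rw [finProj_apply]
    refine Finset.sum_congr rfl fun a _ => ?_
    simp only [inc, lp.singleContinuousLinearMap_apply]
  have h2 := lp.norm_sum_single (p := 2) (by simp) (fun a => f a) F
  have h3 := lp.sum_rpow_le_norm_rpow (p := 2) (by simp) f F
  rw [← h1] at h2
  rw [← h2] at h3
  exact (Real.rpow_le_rpow_iff (norm_nonneg _) (norm_nonneg _) (by simp)).1 h3

theorem inner_finProj (F : Finset X.At) (f g : X.Hilb) :
    ⟪f, X.finProj F g⟫_ℂ = ⟪X.finProj F f, g⟫_ℂ := by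
  simp only [finProj_apply, inner_sum, sum_inner, inner_inc_left, inner_inc_right]

/-- The truncating projections are self-adjoint contractions that converge strongly to the identity.
The terms `⟪P xₙ, T (P yₙ)⟫` therefore converge and are dominated by `‖T‖ ‖xₙ‖ ‖yₙ‖`; dominated
convergence for series holds along any filter, so the set of atoms may be uncountable. -/
theorem tendsto_ultraweak_finProj (T : X.Hilb →L[ℂ] X.Hilb) :
    Filter.Tendsto (fun F => X.finProj F ∘L T ∘L X.finProj F) Filter.atTop
      (@nhds _ (ultraweakTopology X.Hilb) T) := by
  refine tendsto_ultraweak_iff.2 fun x y => ?_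
  refine tendsto_tsum_of_dominated_convergence (bound := fun n => ‖T‖ * (‖x n‖ * ‖y n‖))
    ((summable_norm_mul_norm x y).mul_left _) (fun n => ?_) (Filter.Eventually.of_forall fun F n => ?_)
  · simp only [ContinuousLinearMap.comp_apply, inner_finProj]
    exact (X.tendsto_finProj _).inner ((T.continuous.tendsto _).comp (X.tendsto_finProj _))
  · simp only [ContinuousLinearMap.comp_apply, inner_finProj]
    calc _ ≤ ‖X.finProj F (x n)‖ * ‖T (X.finProj F (y n))‖ := norm_inner_le_norm _ _
      _ ≤ ‖x n‖ * (‖T‖ * ‖y n‖) := by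
          gcongr
          · exact X.norm_finProj_le _ _
          · exact (T.le_opNorm _).trans (by gcongr; exact X.norm_finProj_le _ _)
      _ = _ := by ring

/-- Atoms are finite-dimensional, so a block is a finite combination of fixed rank-one operators
with matrix coefficients of the operator as scalars; weak convergence thus gives norm convergence of
blocks. -/
theorem tendsto_block {α : Type*} {l : Filter α} {f : α → X.Hilb →L[ℂ] X.Hilb}
    {T : X.Hilb →L[ℂ] X.Hilb} (a b : X.At)
    (h : ∀ x y, Filter.Tendsto (fun k => ⟪x, f k y⟫_ℂ) l (𝓝 ⟪x, T y⟫_ℂ)) :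
    Filter.Tendsto (fun k => X.block (f k) a b) l (𝓝 (X.block T a b)) := by
  have expand : ∀ S : X.Hilb →L[ℂ] X.Hilb, X.block S a b =
      ∑ k, ∑ l, ⟪X.inc b (stdOrthonormalBasis ℂ (X.H b) l),
        S (X.inc a (stdOrthonormalBasis ℂ (X.H a) k))⟫_ℂ •
        InnerProductSpace.rankOne ℂ (stdOrthonormalBasis ℂ (X.H b) l)
          (stdOrthonormalBasis ℂ (X.H a) k) := by
    intro S
    ext x
    conv_lhs => rw [← (stdOrthonormalBasis ℂ (X.H a)).sum_repr' x, map_sum]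
    rw [sum_apply]
    refine Finset.sum_congr rfl fun k _ => ?_
    rw [map_smul, ← (stdOrthonormalBasis ℂ (X.H b)).sum_repr' (X.block S a b _), Finset.smul_sum,
      sum_apply]
    refine Finset.sum_congr rfl fun l _ => ?_
    rw [smul_apply, InnerProductSpace.rankOne_apply, smul_comm, inner_inc_left, block_apply]
  simp only [expand]
  exact tendsto_finsetSum _ fun k _ => tendsto_finsetSum _ fun l _ => (h _ _).smul_const _

theorem block_mem_of_tendsto {α : Type*} {l : Filter α} [l.NeBot] {f : α → X.Hilb →L[ℂ] X.Hilb}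
    {T : X.Hilb →L[ℂ] X.Hilb} {a b : X.At} {S : Submodule ℂ (X.H a →L[ℂ] X.H b)}
    (h : ∀ x y, Filter.Tendsto (fun k => ⟪x, f k y⟫_ℂ) l (𝓝 ⟪x, T y⟫_ℂ))
    (hf : ∀ k, X.block (f k) a b ∈ S) : X.block T a b ∈ S :=
  S.closed_of_finiteDimensional.mem_of_tendsto (X.tendsto_block a b h)
    (Filter.Eventually.of_forall hf)

theorem isClosed_ofBinRel (R : BinRel X X) :
    IsClosed[ultraweakTopology X.Hilb] (X.ofBinRel R : Set (X.Hilb →L[ℂ] X.Hilb)) := by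
  refine (@isClosed_iff_forall_filter _ (ultraweakTopology X.Hilb) _).2 fun T l hl hR hT a b => ?_
  refine (R a b).closed_of_finiteDimensional.mem_of_tendsto (f := fun S => X.block S a b) (b := l)
    (X.tendsto_block a b fun x y => ?_) (Filter.mem_of_superset (Filter.le_principal_iff.1 hR) fun S hS => hS a b)
  exact ((@Continuous.tendsto _ _ (ultraweakTopology X.Hilb) _ _
    (continuous_ultraweak_inner x y) T)).mono_left hT

/-- A block of `S * T` is formally an infinite sum over intermediate atoms. Inserting the projection
onto finitely many atoms makes the sum finite, and the limit stays in `R a c`, which is closed. -/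
theorem mul_mem_ofBinRel {R : BinRel X X}
    (hR : ∀ a b c, ∀ r ∈ R a b, ∀ s ∈ R b c, s ∘L r ∈ R a c) {S T : X.Hilb →L[ℂ] X.Hilb}
    (hS : S ∈ X.ofBinRel R) (hT : T ∈ X.ofBinRel R) : S * T ∈ X.ofBinRel R := by
  intro a c
  refine X.block_mem_of_tendsto (l := Filter.atTop) (f := fun F => S ∘L X.finProj F ∘L T)
    (fun x y => ?_) fun F => ?_
  · exact tendsto_const_nhds.inner ((S.continuous.tendsto _).comp (X.tendsto_finProj _))
  · have : X.block (S ∘L X.finProj F ∘L T) a c = ∑ b ∈ F, X.block S b c ∘L X.block T a b := by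
      ext x
      rw [block_apply, sum_apply]
      simp only [ContinuousLinearMap.comp_apply, finProj_apply, map_sum, block_apply]
      rw [lp.coeFn_sum, Finset.sum_apply]
    rw [this]
    exact Submodule.sum_mem _ fun b _ => hR a b c _ (hT a b) _ (hS b c)

end QuantumSet

/-! ### Quantum preorders and their blocks -/

namespace QuantumSet

variable (X : QuantumSet.{u, v})

theorem block_one (i : X.At) : X.block 1 i i = 1 := by
  ext x
  rw [block_apply]
  exact X.inc_apply_self i x

theorem atomProj_mem_commutant (a : X.At) : X.atomProj a ∈ X.linfty.commutant := by
  rw [VonNeumannAlgebra.mem_commutant_iff]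
  intro T hT
  exact ((X.isDiagonal_iff T).1 hT a).symm

theorem unblock_mem_linfty {a : X.At} (t : X.H a →L[ℂ] X.H a) : X.unblock t ∈ X.linfty := by
  refine (X.isDiagonal_iff _).2 fun i => ?_
  ext1 f
  change X.atomProj i (X.unblock t f) = X.unblock t (X.atomProj i f)
  simp only [atomProj_apply, unblock_apply]
  by_cases h : i = a
  · subst h
    rw [inc_apply_self, inc_apply_self]
  · rw [inc_apply_ne X h, inc_apply_ne X (Ne.symm h), map_zero, map_zero, map_zero]

/-- The operators in the commutant of `ℓ^∞(X)` act by a scalar on each atom. -/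
theorem commutant_linfty_le_ofBinRel {R : BinRel X X}
    (hR : ∀ i, (1 : X.H i →L[ℂ] X.H i) ∈ R i i) {T : X.Hilb →L[ℂ] X.Hilb}
    (hT : T ∈ X.linfty.commutant) : T ∈ X.ofBinRel R := by
  rw [VonNeumannAlgebra.mem_commutant_iff] at hT
  have h : ∀ (a : X.At) (t : X.H a →L[ℂ] X.H a) (f : X.Hilb),
      X.inc a (t (T f a)) = T (X.inc a (t (f a))) := by
    intro a t f
    have := congrArg (fun S : X.Hilb →L[ℂ] X.Hilb => S f) (hT _ (X.unblock_mem_linfty t))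
    change X.unblock t (T f) = T (X.unblock t f) at this
    rwa [unblock_apply, unblock_apply] at this
  intro a b
  by_cases hab : b = a
  · subst hab
    obtain ⟨e, he⟩ := exists_ne (0 : X.H b)
    have h1 : X.block T b b = (⟪e, X.block T b b e⟫_ℂ / ⟪e, e⟫_ℂ) • 1 := by
      ext x
      -- Commuting with the rank-one operator from `e` to `x` expresses the block at `x` as a
      -- multiple of `x`, with a factor that does not depend on `x`.
      have h2 := h b (InnerProductSpace.rankOne ℂ x e) (X.inc b e)
      rw [inc_apply_self, InnerProductSpace.rankOne_apply, InnerProductSpace.rankOne_apply] at h2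
      have h3 : ⟪e, X.block T b b e⟫_ℂ • x = ⟪e, e⟫_ℂ • X.block T b b x := by
        rw [← map_smul (X.block T b b), block_apply, block_apply, ← h2]
        exact (X.inc_apply_self b _).symm
      rw [smul_apply, div_eq_inv_mul, mul_smul]
      change _ = _ • _ • x
      rw [h3, inv_smul_smul₀ (inner_self_ne_zero.2 he)]
    rw [h1]
    exact Submodule.smul_mem _ _ (hR b)
  · convert Submodule.zero_mem _
    ext x
    -- With the identity of the atom in place of `t`, `T` commutes with the projection onto `a`, so
    -- it has no block from `a` to another atom.
    have h2 : X.inc a (T (X.inc a x) a) = T (X.inc a (X.inc a x a)) := h a 1 _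
    rw [inc_apply_self] at h2
    rw [block_apply, ← h2, inc_apply_ne X hab]
    rfl

theorem atomProj_mem {V : Subalgebra ℂ (X.Hilb →L[ℂ] X.Hilb)} (hV : IsQuantumPreorder X.linfty V)
    (a : X.At) : X.atomProj a ∈ V :=
  hV.commutant_le (X.atomProj_mem_commutant a)

/-- A quantum preorder is determined by its blocks. -/
theorem ofBinRel_compress {V : Subalgebra ℂ (X.Hilb →L[ℂ] X.Hilb)}
    (hV : IsQuantumPreorder X.linfty V) :
    X.ofBinRel (X.compress (Subalgebra.toSubmodule V)) = Subalgebra.toSubmodule V := by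
  refine le_antisymm (fun T hT => ?_) fun T hT a b => ⟨T, hT, rfl⟩
  refine @IsClosed.mem_of_tendsto _ (ultraweakTopology X.Hilb) _ _ _ _ _ _ hV.isClosed
    (X.tendsto_ultraweak_finProj T) (Filter.Eventually.of_forall fun F => ?_)
  have h1 : X.finProj F ∘L T ∘L X.finProj F =
      ∑ b ∈ F, ∑ a ∈ F, X.atomProj b * (T * X.atomProj a) := by
    change X.finProj F * (T * X.finProj F) = _
    simp only [finProj, Finset.mul_sum, Finset.sum_mul]
    exact Finset.sum_comm
  rw [h1]
  refine V.sum_mem fun b _ => V.sum_mem fun a _ => ?_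
  obtain ⟨S, hS, hST⟩ := hT a b
  -- Between two atom projections only one block survives, so `T` may be replaced by an element of
  -- `V` with the same block.
  have h2 : X.atomProj b * (T * X.atomProj a) = X.atomProj b * (S * X.atomProj a) := by
    ext1 f
    have := congrArg (fun r : X.H a →L[ℂ] X.H b => X.inc b (r (f a))) hST
    change X.inc b (X.block S a b _) = X.inc b (X.block T a b _) at this
    rw [block_apply, block_apply] at this
    change X.atomProj b (T (X.atomProj a f)) = X.atomProj b (S (X.atomProj a f))
    simp only [atomProj_apply]
    exact this.symm
  rw [h2]
  exact V.mul_mem (X.atomProj_mem hV b) (V.mul_mem hS (X.atomProj_mem hV a))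

theorem one_mem_compress (V : Subalgebra ℂ (X.Hilb →L[ℂ] X.Hilb)) (i : X.At) :
    (1 : X.H i →L[ℂ] X.H i) ∈ X.compress (Subalgebra.toSubmodule V) i i :=
  ⟨1, V.one_mem, X.block_one i⟩

/-- Composing two blocks inserts the projection onto the middle atom, and this projection belongs to
`V`. -/
theorem comp_mem_compress {V : Subalgebra ℂ (X.Hilb →L[ℂ] X.Hilb)}
    (hV : IsQuantumPreorder X.linfty V) (a b c : X.At) :
    ∀ r ∈ X.compress (Subalgebra.toSubmodule V) a b,
      ∀ s ∈ X.compress (Subalgebra.toSubmodule V) b c,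
      s ∘L r ∈ X.compress (Subalgebra.toSubmodule V) a c := by
  rintro _ ⟨T, hT, rfl⟩ _ ⟨S, hS, rfl⟩
  exact ⟨S * (X.atomProj b * T), V.mul_mem hS (V.mul_mem (X.atomProj_mem hV b) hT), rfl⟩

/-- The algebra of the operators whose blocks belong to a given reflexive and transitive binary
relation. -/
def algebraOfBinRel (R : BinRel X X) (h1 : ∀ i, (1 : X.H i →L[ℂ] X.H i) ∈ R i i)
    (h2 : ∀ a b c, ∀ r ∈ R a b, ∀ s ∈ R b c, s ∘L r ∈ R a c) :
    Subalgebra ℂ (X.Hilb →L[ℂ] X.Hilb) :=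
  (X.ofBinRel R).toSubalgebra (X.commutant_linfty_le_ofBinRel h1 (one_mem _))
    fun _ _ => X.mul_mem_ofBinRel h2

theorem isQuantumPreorder_algebraOfBinRel (R : BinRel X X)
    (h1 : ∀ i, (1 : X.H i →L[ℂ] X.H i) ∈ R i i)
    (h2 : ∀ a b c, ∀ r ∈ R a b, ∀ s ∈ R b c, s ∘L r ∈ R a c) :
    IsQuantumPreorder X.linfty (X.algebraOfBinRel R h1 h2) where
  isClosed := X.isClosed_ofBinRel R
  commutant_le _ hT := X.commutant_linfty_le_ofBinRel h1 hT

/-- `ofBinRel` inverts `compress` on quantum preorders, and the reflexive and transitive relations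
are those for which it yields a quantum preorder. -/
theorem bijOn_compress :
    Set.BijOn (fun V : Subalgebra ℂ (X.Hilb →L[ℂ] X.Hilb) => X.compress (Subalgebra.toSubmodule V))
        {V | IsQuantumPreorder X.linfty V}
        {R : BinRel X X | R.reflSentence.Holds ∧ R.transSentence.Holds} := by
  refine ⟨fun V hV => ?_, fun V hV W hW h => ?_, fun R hR => ?_⟩
  · exact ⟨(BinRel.reflSentence_holds_iff _).2 (X.one_mem_compress V),
      (BinRel.transSentence_holds_iff _).2 (X.comp_mem_compress hV)⟩
  · refine Subalgebra.toSubmodule_injective ?_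
    rw [← X.ofBinRel_compress hV, ← X.ofBinRel_compress hW]
    exact congrArg X.ofBinRel h
  · have h1 := (BinRel.reflSentence_holds_iff R).1 hR.1
    have h2 := (BinRel.transSentence_holds_iff R).1 hR.2
    exact ⟨X.algebraOfBinRel R h1 h2, X.isQuantumPreorder_algebraOfBinRel R h1 h2,
      X.compress_ofBinRel R⟩

theorem adjoint_block (T : X.Hilb →L[ℂ] X.Hilb) (a b : X.At) :
    ContinuousLinearMap.adjoint (X.block T a b) = X.block (star T) b a := by
  rw [ContinuousLinearMap.star_eq_adjoint, block, block, ContinuousLinearMap.adjoint_comp,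
    ContinuousLinearMap.adjoint_comp, ContinuousLinearMap.adjoint_adjoint]
  rfl

end QuantumSet

/-! ### The double commutant -/

section

variable {H : Type*} [NormedAddCommGroup H] [InnerProductSpace ℂ H]

/-- The diagonal action of an operator on finite families of vectors. -/
def diagAction (n : ℕ) (T : H →L[ℂ] H) (f : PiLp 2 fun _ : Fin n => H) :
    PiLp 2 fun _ : Fin n => H :=
  WithLp.toLp 2 fun i => T (f i)

theorem continuous_diagAction (n : ℕ) (T : H →L[ℂ] H) : Continuous (diagAction n T) :=
  (PiLp.continuous_toLp 2 _).comp
    (continuous_pi fun i => T.continuous.comp (PiLp.continuous_apply 2 _ i))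

theorem inner_diagAction [CompleteSpace H] (n : ℕ) (T : H →L[ℂ] H) (f g : PiLp 2 fun _ : Fin n => H) :
    ⟪diagAction n T f, g⟫_ℂ = ⟪f, diagAction n (star T) g⟫_ℂ := by
  simp [PiLp.inner_apply, diagAction, ContinuousLinearMap.star_eq_adjoint,
    ContinuousLinearMap.adjoint_inner_right]

/-- The action of operators on a finite family of vectors. -/
def evalFamily {n : ℕ} (ξ : Fin n → H) : (H →L[ℂ] H) →ₗ[ℂ] PiLp 2 fun _ : Fin n => H where
  toFun T := WithLp.toLp 2 fun i => T (ξ i)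
  map_add' _ _ := rfl
  map_smul' _ _ := rfl

/-- An operator in the double commutant of a unital *-algebra is approximated by operators in the
algebra on each finite family of vectors. -/
theorem evalFamily_mem_closure [CompleteSpace H] (V : StarSubalgebra ℂ (H →L[ℂ] H)) {T : H →L[ℂ] H}
    (hT : T ∈ Set.centralizer (Set.centralizer (V : Set (H →L[ℂ] H)))) {n : ℕ} (ξ : Fin n → H) :
    evalFamily ξ T ∈
      ((Subalgebra.toSubmodule V.toSubalgebra).map (evalFamily ξ)).topologicalClosure := by
  set W := ((Subalgebra.toSubmodule V.toSubalgebra).map (evalFamily ξ)).topologicalClosure with hW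
  have : CompleteSpace W := (Submodule.isClosed_topologicalClosure _).completeSpace_coe
  have hinv : ∀ S ∈ V, ∀ f ∈ W, diagAction n S f ∈ W := by
    intro S hS f hf
    refine map_mem_closure (continuous_diagAction n S) hf ?_
    rintro _ ⟨S', hS', rfl⟩
    exact ⟨S * S', V.mul_mem hS hS', rfl⟩
  have hsub : ∀ (S : H →L[ℂ] H) (f g : PiLp 2 fun _ : Fin n => H),
      diagAction n S (f - g) = diagAction n S f - diagAction n S g := by
    intro S f g
    ext i
    simp [diagAction]
  -- `W` is invariant under the diagonal action of `V` and of its adjoints, so the projection onto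
  -- `W` commutes with this action.
  have hcomm : ∀ S ∈ V, ∀ f, W.starProjection (diagAction n S f) =
      diagAction n S (W.starProjection f) := by
    intro S hS f
    refine Submodule.eq_starProjection_of_mem_of_inner_eq_zero
      (hinv S hS _ (Submodule.starProjection_apply_mem W f)) fun w hw => ?_
    rw [← hsub, inner_diagAction]
    exact W.starProjection_inner_eq_zero f _ (hinv _ (star_mem hS) w hw)
  have hentry : ∀ i j, ∃ P : H →L[ℂ] H, ∀ x, P x = W.starProjection (PiLp.single 2 j x) i := by
    intro i j
    exact ⟨(PiLp.proj 2 (fun _ : Fin n => H) i : _ →L[ℂ] H) ∘L W.starProjection ∘L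
      (PiLp.continuousLinearEquiv 2 ℂ fun _ : Fin n => H).symm.toContinuousLinearMap ∘L
      ContinuousLinearMap.single ℂ (fun _ : Fin n => H) j, fun x => rfl⟩
  choose P hP using hentry
  -- The matrix entries of a projection that commutes with the diagonal action of `V` lie in the
  -- commutant of `V`; hence `T` commutes with them, and its diagonal action commutes with the
  -- projection.
  have hPV : ∀ i j, P i j ∈ Set.centralizer (V : Set (H →L[ℂ] H)) := by
    intro i j S hS
    ext x
    change S (P i j x) = P i j (S x)
    rw [hP, hP]
    have h1 : (PiLp.single 2 j (S x) : PiLp 2 fun _ : Fin n => H) =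
        diagAction n S (PiLp.single 2 j x) := by
      ext k
      by_cases h : k = j
      · subst h
        simp [diagAction]
      · simp [diagAction, h]
    rw [h1, hcomm S hS]
    rfl
  have hsum : ∀ f i, W.starProjection f i = ∑ j, P i j (f j) := by
    intro f i
    have h1 : f = ∑ j, PiLp.single 2 j (f j) := by
      ext k
      rw [WithLp.ofLp_sum, Finset.sum_apply, Finset.sum_eq_single k]
      · simp
      · intro j _ hj
        simp [hj.symm]
      · simp
    conv_lhs => rw [h1, map_sum]
    simp [hP]
  have hT' : ∀ f, W.starProjection (diagAction n T f) = diagAction n T (W.starProjection f) := by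
    intro f
    ext i
    rw [hsum]
    change _ = T (W.starProjection f i)
    rw [hsum, map_sum]
    refine Finset.sum_congr rfl fun j _ => ?_
    exact congrArg (fun S : H →L[ℂ] H => S (f j)) (hT (P i j) (hPV i j))
  -- As `V` is unital, the family `ξ` itself lies in `W`, so its image under `T` is fixed by the
  -- projection.
  have h1 : evalFamily ξ 1 ∈ W := Submodule.le_topologicalClosure _ ⟨1, one_mem V, rfl⟩
  have h2 : evalFamily ξ T = W.starProjection (evalFamily ξ T) := by
    have := hT' (evalFamily ξ 1)
    rw [Submodule.starProjection_eq_self_iff.2 h1] at this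
    exact this.symm
  rw [h2]
  exact Submodule.starProjection_apply_mem W _

end

/-! ### Von Neumann algebras from relations -/

namespace QuantumSet

variable (X : QuantumSet.{u, v})

/-- The *-algebra of the operators whose blocks belong to a given reflexive, symmetric and
transitive binary relation. -/
def starAlgebraOfBinRel (R : BinRel X X) (h1 : ∀ i, (1 : X.H i →L[ℂ] X.H i) ∈ R i i)
    (h2 : ∀ a b, ∀ r ∈ R a b, ContinuousLinearMap.adjoint r ∈ R b a)
    (h3 : ∀ a b c, ∀ r ∈ R a b, ∀ s ∈ R b c, s ∘L r ∈ R a c) :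
    StarSubalgebra ℂ (X.Hilb →L[ℂ] X.Hilb) where
  toSubalgebra := X.algebraOfBinRel R h1 h3
  star_mem' {T} hT a b := by
    rw [← adjoint_block]
    exact h2 _ _ _ (hT b a)

/-- A block depends only on the values of the operator at a finite basis of the source atom, which
is the form of data that `evalFamily_mem_closure` approximates. -/
theorem block_eq_sum_rankOne (S : X.Hilb →L[ℂ] X.Hilb) (a b : X.At) :
    X.block S a b = ∑ i, InnerProductSpace.rankOne ℂ (ContinuousLinearMap.adjoint (X.inc b)
      (evalFamily (fun i => X.inc a (stdOrthonormalBasis ℂ (X.H a) i)) S i))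
      (stdOrthonormalBasis ℂ (X.H a) i) := by
  ext x
  conv_lhs => rw [← (stdOrthonormalBasis ℂ (X.H a)).sum_repr' x, map_sum]
  rw [sum_apply]
  refine Finset.sum_congr rfl fun i _ => ?_
  rw [map_smul, InnerProductSpace.rankOne_apply]
  rfl

/-- The block is a continuous function of the values on the basis, so it is a limit of blocks of
elements of `V`; these lie in the closed space `S`. -/
theorem block_mem_of_mem_centralizer {V : StarSubalgebra ℂ (X.Hilb →L[ℂ] X.Hilb)} {a b : X.At}
    {S : Submodule ℂ (X.H a →L[ℂ] X.H b)} (hV : ∀ T ∈ V, X.block T a b ∈ S)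
    {T : X.Hilb →L[ℂ] X.Hilb}
    (hT : T ∈ Set.centralizer (Set.centralizer (V : Set (X.Hilb →L[ℂ] X.Hilb)))) :
    X.block T a b ∈ S := by
  let e := stdOrthonormalBasis ℂ (X.H a)
  let Φ : (PiLp 2 fun _ : Fin (Module.finrank ℂ (X.H a)) => X.Hilb) → (X.H a →L[ℂ] X.H b) :=
    fun f => ∑ i, InnerProductSpace.rankOne ℂ (ContinuousLinearMap.adjoint (X.inc b) (f i)) (e i)
  have hΦ : Continuous Φ := by
    refine continuous_finsetSum _ fun i _ => ?_
    have h : Continuous fun y : X.H b => InnerProductSpace.rankOne ℂ y (e i) :=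
      (ContinuousLinearMap.smulRightL ℂ (X.H a) (X.H b) (innerSL ℂ (e i))).continuous
    exact h.comp ((ContinuousLinearMap.adjoint (X.inc b)).continuous.comp
      (PiLp.continuous_apply 2 (fun _ => X.Hilb) i))
  have hmem : Φ (evalFamily (fun i => X.inc a (e i)) T) ∈ closure (S : Set (X.H a →L[ℂ] X.H b)) := by
    refine map_mem_closure hΦ (evalFamily_mem_closure V hT fun i => X.inc a (e i)) ?_
    rintro _ ⟨T', hT', rfl⟩
    have := hV T' hT'
    rwa [block_eq_sum_rankOne] at this
  rw [block_eq_sum_rankOne]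
  rwa [S.closed_of_finiteDimensional.closure_eq] at hmem

/-- The von Neumann algebra of the operators whose blocks belong to a given reflexive, symmetric
and transitive binary relation. -/
def vonNeumannAlgebraOfBinRel (R : BinRel X X) (h1 : ∀ i, (1 : X.H i →L[ℂ] X.H i) ∈ R i i)
    (h2 : ∀ a b, ∀ r ∈ R a b, ContinuousLinearMap.adjoint r ∈ R b a)
    (h3 : ∀ a b c, ∀ r ∈ R a b, ∀ s ∈ R b c, s ∘L r ∈ R a c) :
    VonNeumannAlgebra X.Hilb where
  toStarSubalgebra := X.starAlgebraOfBinRel R h1 h2 h3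
  centralizer_centralizer' := by
    refine Set.Subset.antisymm (fun T hT a b => ?_) Set.subset_centralizer_centralizer
    exact X.block_mem_of_mem_centralizer (V := X.starAlgebraOfBinRel R h1 h2 h3)
      (fun T hT => hT a b) hT

/-- Commutants are ultraweakly closed and reverse inclusions, so part (b) concerns a subfamily of
the quantum preorders of part (a). -/
theorem isQuantumPreorder_commutant {M : VonNeumannAlgebra X.Hilb} (hM : M ≤ X.linfty) :
    IsQuantumPreorder X.linfty M.commutant.toStarSubalgebra.toSubalgebra where
  isClosed := M.isClosed_commutant
  commutant_le T hT := by
    change T ∈ M.commutant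
    rw [VonNeumannAlgebra.mem_commutant_iff]
    exact fun S hS => VonNeumannAlgebra.mem_commutant_iff.1 hT S (hM hS)

end QuantumSet

end

/-! ### The two bijections -/

theorem mainTheorem5 (X : QuantumSet.{u, v}) :
    Set.BijOn (fun V : Subalgebra ℂ (X.Hilb →L[ℂ] X.Hilb) => X.compress (Subalgebra.toSubmodule V))
        {V | IsQuantumPreorder X.linfty V}
        {R : BinRel X X | R.reflSentence.Holds ∧ R.transSentence.Holds} ∧
      Set.BijOn (fun M : VonNeumannAlgebra X.Hilb => X.compress M.commutant.toSubmodule)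
        {M | M ≤ X.linfty}
        {R : BinRel X X |
          R.reflSentence.Holds ∧ R.symmSentence.Holds ∧ R.transSentence.Holds} := by
  refine ⟨X.bijOn_compress, fun M hM => ?_, fun M hM N hN h => ?_, fun R hR => ?_⟩
  · have h := X.bijOn_compress.mapsTo (X.isQuantumPreorder_commutant hM)
    refine ⟨h.1, (BinRel.symmSentence_holds_iff _).2 ?_, h.2⟩
    rintro a b _ ⟨T, hT, rfl⟩
    exact ⟨star T, star_mem (S := VonNeumannAlgebra X.Hilb) (s := M.commutant) hT,
      (X.adjoint_block T a b).symm⟩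
  · have h1 := X.bijOn_compress.injOn (X.isQuantumPreorder_commutant hM)
      (X.isQuantumPreorder_commutant hN) h
    have h2 : M.commutant = N.commutant := VonNeumannAlgebra.ext fun T => SetLike.ext_iff.1 h1 T
    rw [← M.commutant_commutant, h2, N.commutant_commutant]
  · have h1 := (BinRel.reflSentence_holds_iff R).1 hR.1
    have h2 := (BinRel.symmSentence_holds_iff R).1 hR.2.1
    have h3 := (BinRel.transSentence_holds_iff R).1 hR.2.2
    let N := X.vonNeumannAlgebraOfBinRel R h1 h2 h3
    -- The preimage is the commutant of `N`, since the assignment compresses `M'`. It lies in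
    -- `ℓ^∞(X)` because reflexivity puts the commutant of `ℓ^∞(X)` into `N`.
    refine ⟨N.commutant, fun T hT => ?_, ?_⟩
    · rw [← X.linfty.commutant_commutant, VonNeumannAlgebra.mem_commutant_iff]
      exact fun S hS => VonNeumannAlgebra.mem_commutant_iff.1 hT S
        (X.commutant_linfty_le_ofBinRel h1 hS)
    · change X.compress N.commutant.commutant.toSubmodule = R
      rw [N.commutant_commutant]
      exact X.compress_ofBinRel R
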